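/- **Theorem 3.15 ($p$-adic explicit tube formula).** *Setting.* Let $p$ be a prime, $\mu_H$ the Haar measure on $\mathbb Q_p$ with $\mu_H(\mathbb Z_p)=1$, and let $\mathcal L_p$ be a $p$-adic fractal string, that is, a bounded open set $\Omega\subset\mathbb Q_p$, written canonically as the disjoint union of the maximal balls $B_j=a_j+p^{n_j}\mathbb Z_p$ contained in $\Omega$, with arbitrarily chosen centers $a_j\in B_j$. Let $\beta\mathcal L_p=\bigcup_j\{x:|x-a_j|_p=p^{-n_j}\}$, and for $\varepsilon>0$ let $V_{\mathcal L_p}(\varepsilon)=\mu_H\big(\{x\in\Omega: d_p(x,\beta\mathcal L_p)<\varepsilon\}\setminus\beta\mathcal L_p\big)$ be the volume of the thin inner $\varepsilon$-neighborhood. Let $\sigma\in[-\infty,\infty)$ be the infimum of the real $\alpha$ with $\sum_j p^{-n_j\alpha}<\infty$, and let $\zeta_{\mathcal L_p}$ denote the series $\sum_j p^{-n_js}$ ($\Re s>\sigma$) as well as its meromorphic continuation. Assume $\sigma<1$. A *screen* is the curve $\{S(t)+it:t\in\mathbb R\}$ of a bounded Lipschitz function $S:\mathbb R\to\mathbb R$;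 put $\sup S=\sup_t S(t)$; its *window* is $W=\{s:\Re s\ge S(\Im s)\}$. If $\zeta_{\mathcal L_p}$ continues meromorphically to an open connected neighborhood of $W$, then $\mathcal D_{\mathcal L_p}(W)$ is the set of its poles in $W$, and $\mathcal D_{\mathcal L_p}=\mathcal D_{\mathcal L_p}(\mathbb C)$ if it continues to $\mathbb C$. *Heights* are a sequence $(T_n)_{n\in\mathbb Z}$ of reals with $T_{-n}<0<T_n$ for $n\ge1$, $T_n\to\infty$, $T_{-n}\to-\infty$ and $T_n/|T_{-n}|\to1$ as $n\to\infty$. An inequality for $|\zeta_{\mathcal L_p}(s)|$ includes that $s$ is not a pole. **(i)** Let $S$ be a screen with $\sup S<1$ such that $\zeta_{\mathcal L_p}$ has a meromorphic continuation to an open connected neighborhood of $W$ without poles on the screen. Suppose $\mathcal L_p$ is languid: for some $\kappa\in\mathbb R$, $C>0$ and heights $(T_n)$, $$|\zeta_{\mathcal L_p}(u+iT_n)|\le C(|T_n|+1)^\kappa\quad(n\in\mathbb Z,\ u\ge S(T_n)),\qquad |\zeta_{\mathcal L_p}(S(t)+it)|\le C|t|^\kappa\quad(|t|\ge1).$$ Then,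 as distributions on $(0,\infty)$, $$V_{\mathcal L_p}(\varepsilon)=\sum_{\omega\in\mathcal D_{\mathcal L_p}(W)}\mathrm{res}\Big(\frac{p^{-1}\zeta_{\mathcal L_p}(s)\varepsilon^{1-s}}{1-s};\omega\Big)+\mathcal R_p(\varepsilon),\qquad \mathcal R_p(\varepsilon)=\frac1{2\pi i}\int_S\frac{p^{-1}\zeta_{\mathcal L_p}(s)\varepsilon^{1-s}}{1-s}\,ds .$$ That is, for every $\varphi\in C_c^\infty(0,\infty)$: each set $\{\omega\in\mathcal D_{\mathcal L_p}(W):T_{-n}<\Im\omega<T_n\}$ is finite, the sums over these sets of the residue terms applied to $\varphi$ (integrated against $\varphi$ over $(0,\infty)$) converge as $n\to\infty$, $\langle\mathcal R_p,\varphi\rangle=\frac1{2\pi i}\int_S\int_0^\infty\frac{p^{-1}\zeta_{\mathcal L_p}(s)\varepsilon^{1-s}}{1-s}\varphi(\varepsilon)\,d\varepsilon\,ds$ converges absolutely, and $\int_0^\infty V_{\mathcal L_p}\varphi\,d\varepsilon$ equals the limit of the sums plus $\langle\mathcal R_p,\varphi\rangle$. Moreover $\mathcal R_p(\varepsilon)=O(\varepsilon^{1-\sup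 S})$ as $\varepsilon\to0^+$ distributionally: for every $\varphi\in C_c^\infty(0,\infty)$, with $\varphi_a(\varepsilon)=a^{-1}\varphi(\varepsilon/a)$, $\langle\mathcal R_p,\varphi_a\rangle=O(a^{1-\sup S})$ as $a\to0^+$. **(ii)** Suppose $\mathcal L_p$ is strongly languid: $\zeta_{\mathcal L_p}$ continues meromorphically to $\mathbb C$, and for some $\kappa\in\mathbb R$, $A,C>0$, heights $(T_n)$ and screens $S_m$ with $\sup S_m\to-\infty$ and uniformly bounded Lipschitz constants, $$|\zeta_{\mathcal L_p}(u+iT_n)|\le C(|T_n|+1)^\kappa\quad(n\in\mathbb Z,\ u\in\mathbb R),\qquad |\zeta_{\mathcal L_p}(S_m(t)+it)|\le C A^{|S_m(t)|}(|t|+1)^\kappa\quad(t\in\mathbb R,\ m\ge1).$$ Then one can take $W=\mathbb C$ and $\mathcal R_p\equiv0$ on test functions supported in compact subsets of $[0,A^{-1})$: $$V_{\mathcal L_p}(\varepsilon)=\sum_{\omega\in\mathcal D_{\mathcal L_p}}\mathrm{res}\Big(\frac{p^{-1}\zeta_{\mathcal L_p}(s)\varepsilon^{1-s}}{1-s};\omega\Big).$$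 That is, for every $\varphi\in C_c^\infty(\mathbb R)$ with support in $(-\infty,A^{-1})$, integrated over $(0,\infty)$: the sum over $\mathcal D_{\mathcal L_p}$ is the limit as $m\to\infty$ of the sums over $\mathcal D_{\mathcal L_p}(W_m)$, where $W_m$ is the window of $S_m$; for all large $m$ the latter sums converge in the sense of (i), and the limit as $m\to\infty$ exists and equals $\int_0^\infty V_{\mathcal L_p}\varphi\,d\varepsilon$. If the real parts of the complex dimensions are bounded below, then also the sums over $\{\omega\in\mathcal D_{\mathcal L_p}:T_{-n}<\Im\omega<T_n\}$ converge to $\int_0^\infty V_{\mathcal L_p}\varphi\,d\varepsilon$ as $n\to\infty$. -/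

import Mathlib

open Set Filter Topology MeasureTheory Complex
open scoped NNReal

namespace PadicString

noncomputable section

/-! ### Normalized Haar measure on the field of `p`-adic numbers -/

instance instMeasurableSpacePadic (p : ℕ) [Fact p.Prime] : MeasurableSpace ℚ_[p] :=
  borel ℚ_[p]

instance instBorelSpacePadic (p : ℕ) [Fact p.Prime] : BorelSpace ℚ_[p] := ⟨rfl⟩

theorem unitBall_interior_nonempty (p : ℕ) [Fact p.Prime] :
    (interior (Metric.closedBall (0 : ℚ_[p]) 1)).Nonempty :=
  ⟨0, Metric.ball_subset_interior_closedBall (Metric.mem_ball_self one_pos)⟩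

/-- The Haar measure `μ_H` on `ℚ_p`, normalized by `μ_H(ℤ_p) = 1`. -/
def haar (p : ℕ) [Fact p.Prime] : Measure ℚ_[p] :=
  Measure.addHaarMeasure
    ⟨⟨Metric.closedBall 0 1, isCompact_closedBall 0 1⟩, unitBall_interior_nonempty p⟩

/-! ### Fractal strings, their lengths and their zeta functions -/

variable {p : ℕ} [Fact p.Prime]

/-- The equivalence relation on an open set `Ω`: `x` and `y` lie in a common ball
contained in `Ω`. -/
def SameComponent (Ω : Set ℚ_[p]) (x y : ℚ_[p]) : Prop :=
  ∃ (a : ℚ_[p]) (r : ℝ), 0 < r ∧ Metric.closedBall a r ⊆ Ω ∧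
    x ∈ Metric.closedBall a r ∧ y ∈ Metric.closedBall a r

/-- The set of equivalence classes (convex components) of `Ω`. For a bounded open `Ω` these
are the maximal balls `a_j + p ^ n_j ℤ_p` contained in `Ω`. -/
def components (Ω : Set ℚ_[p]) : Set (Set ℚ_[p]) :=
  {B | ∃ x ∈ Ω, B = {y | SameComponent Ω x y}}

/-- The length of a component: its Haar measure. -/
def len (B : Set ℚ_[p]) : ℝ := (haar p).real B

/-- The abscissa of convergence `σ` of the Dirichlet series of the string, as an extended real
number (it is `⊥` when there are finitely many components). -/
def abscissa (Ω : Set ℚ_[p]) : EReal :=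
  sInf ((fun α : ℝ => (α : EReal)) ''
    {α : ℝ | Summable fun B : components Ω => len (B : Set ℚ_[p]) ^ α})

/-- The Dirichlet series `∑_j (μ_H(B_j)) ^ s` defining the geometric zeta function. -/
def zetaSeries (Ω : Set ℚ_[p]) (s : ℂ) : ℂ :=
  ∑' B : components Ω, (len (B : Set ℚ_[p]) : ℂ) ^ s

/-! ### Thin inner tubes -/

/-- The metric boundary `βΩ` for a choice `c` of centres: the union of the spheres of radius
`p ^ (-n)` around `c B`, over the components `B = B(c B, p ^ (-n))` of `Ω`. -/
def metricBoundary (Ω : Set ℚ_[p]) (c : Set ℚ_[p] → ℚ_[p]) : Set ℚ_[p] :=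
  {x | ∃ B ∈ components Ω, ∃ n : ℤ,
    B = Metric.closedBall (c B) ((p : ℝ) ^ (-n)) ∧ x ∈ Metric.sphere (c B) ((p : ℝ) ^ (-n))}

/-- The thick inner `ε`-neighborhood. -/
def thickTube (Ω : Set ℚ_[p]) (c : Set ℚ_[p] → ℚ_[p]) (ε : ℝ) : Set ℚ_[p] :=
  {x | x ∈ Ω ∧ Metric.infDist x (metricBoundary Ω c) < ε}

/-- The thin inner `ε`-neighborhood. -/
def thinTube (Ω : Set ℚ_[p]) (c : Set ℚ_[p] → ℚ_[p]) (ε : ℝ) : Set ℚ_[p] :=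
  thickTube Ω c ε \ metricBoundary Ω c

/-- The volume `V(ε)` of the thin inner `ε`-neighborhood. -/
def tubeVolume (Ω : Set ℚ_[p]) (c : Set ℚ_[p] → ℚ_[p]) (ε : ℝ) : ℝ :=
  (haar p).real (thinTube Ω c ε)

/-! ### Screens, windows, meromorphic continuation -/

/-- A screen is (the graph of) a bounded Lipschitz function. -/
structure IsScreen (S : ℝ → ℝ) : Prop where
  lipschitz : ∃ K : ℝ≥0, LipschitzWith K S
  bounded : ∃ M : ℝ, ∀ t, |S t| ≤ M

/-- The point `S(t) + i t` of the screen. -/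
def screenPoint (S : ℝ → ℝ) (t : ℝ) : ℂ := (S t : ℂ) + (t : ℂ) * I

/-- The window: the closed region to the right of the screen. -/
def window (S : ℝ → ℝ) : Set ℂ := {s | S s.im ≤ s.re}

/-- `f` is the meromorphic continuation of the geometric zeta function of `Ω` to the open
connected set `U` (normalized by the value `0` at its poles, and analytic elsewhere). -/
structure IsContinuation (Ω : Set ℚ_[p]) (U : Set ℂ) (f : ℂ → ℂ) : Prop where
  isOpen : IsOpen U
  isPreconnected : IsPreconnected U
  meromorphic : MeromorphicNFOn f U
  eq_series : ∀ s ∈ U, abscissa Ω < (s.re : EReal) → f s = zetaSeries Ω s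

/-- `s` is a pole of `f`. -/
def IsPole (f : ℂ → ℂ) (s : ℂ) : Prop := meromorphicOrderAt f s < 0

/-- The inequality `|f(s)| ≤ M` for a meromorphic function: `s` is not a pole and the value of
`f` at `s` is at most `M` in absolute value. -/
def BoundAt (f : ℂ → ℂ) (s : ℂ) (M : ℝ) : Prop := ¬ IsPole f s ∧ ‖f s‖ ≤ M

/-- The complex dimensions visible in `W`. -/
def visibleDimensions (f : ℂ → ℂ) (W : Set ℂ) : Set ℂ := {w | w ∈ W ∧ IsPole f w}

/-! ### Languidity -/

/-- The conditions on the two-sided sequence of heights `T_n`. -/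
structure IsHeights (T : ℤ → ℝ) : Prop where
  pos : ∀ n : ℕ, 1 ≤ n → 0 < T n
  neg : ∀ n : ℕ, 1 ≤ n → T (-n) < 0
  tendsto_top : Tendsto (fun n : ℕ => T n) atTop atTop
  tendsto_bot : Tendsto (fun n : ℕ => T (-n)) atTop atBot
  ratio : Tendsto (fun n : ℕ => T n / |T (-n)|) atTop (𝓝 1)

/-- `f` satisfies the languidity conditions L1 (along horizontal lines) and L2 (along the
screen), with the exponent `κ`, the constant `C` and the heights `T`. -/
structure IsLanguid (f : ℂ → ℂ) (S : ℝ → ℝ) (κ C : ℝ) (T : ℤ → ℝ) : Prop where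
  const_pos : 0 < C
  heights : IsHeights T
  horizontal : ∀ (n : ℤ) (u : ℝ), S (T n) ≤ u →
    BoundAt f ((u : ℂ) + (T n : ℂ) * I) (C * (|T n| + 1) ^ κ)
  vertical : ∀ t : ℝ, 1 ≤ |t| → BoundAt f (screenPoint S t) (C * |t| ^ κ)

/-- Strong languidity: L1 on whole horizontal lines, and L2' along a sequence of screens `S_m`
with a uniform Lipschitz bound that move off to `-∞`. -/
structure IsStronglyLanguid (f : ℂ → ℂ) (S : ℕ → ℝ → ℝ) (κ A C : ℝ) (T : ℤ → ℝ) : Prop where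
  const_pos : 0 < C
  base_pos : 0 < A
  heights : IsHeights T
  horizontal : ∀ (n : ℤ) (u : ℝ), BoundAt f ((u : ℂ) + (T n : ℂ) * I) (C * (|T n| + 1) ^ κ)
  screens : ∀ m, IsScreen (S m)
  lipschitz : ∃ K : ℝ≥0, ∀ m, LipschitzWith K (S m)
  sup_tendsto : Tendsto (fun m => ⨆ t, S m t) atTop atBot
  vertical : ∀ (m : ℕ) (t : ℝ),
    BoundAt f (screenPoint (S m) t) (C * A ^ |S m t| * (|t| + 1) ^ κ)

/-! ### Residues and the distributions in the tube formula -/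

/-- The residue of `g` at `w`: the normalized integral over small positively oriented circles
around `w` (which is eventually independent of the radius when `g` is meromorphic at `w`). -/
def residue (g : ℂ → ℂ) (w : ℂ) : ℂ :=
  limUnder (𝓝[>] (0 : ℝ)) fun r => (2 * Real.pi * I)⁻¹ * ∮ z in C(w, r), g z

/-- The function `p⁻¹ ζ(s) ε ^ (1 - s) / (1 - s)`. -/
def tubularZeta (p : ℕ) (f : ℂ → ℂ) (ε : ℝ) (s : ℂ) : ℂ :=
  (p : ℂ)⁻¹ * f s * (ε : ℂ) ^ (1 - s) / (1 - s)

/-- The function of `ε` contributed by the complex dimension `w`. -/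
def residueTerm (p : ℕ) (f : ℂ → ℂ) (w : ℂ) (ε : ℝ) : ℂ := residue (tubularZeta p f ε) w

/-- The distribution on `(0, ∞)` given by a function `g`, applied to `φ`. -/
def pairing (g φ : ℝ → ℂ) : ℂ := ∫ ε in Ioi (0 : ℝ), g ε * φ ε

/-- The sum of the distributions `residueTerm p f w`, applied to `φ`, over the `w ∈ D` with
`T_{-n} < Im w < T_n`. -/
def truncatedSum (p : ℕ) (f : ℂ → ℂ) (D : Set ℂ) (T : ℤ → ℝ) (φ : ℝ → ℂ) (n : ℕ) : ℂ :=
  ∑ᶠ w ∈ {w | w ∈ D ∧ T (-n) < w.im ∧ w.im < T n}, pairing (residueTerm p f w) φ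

/-- The integrand, in the parameter `t`, of the error term applied to `φ`; `S'(t) + i` is the
derivative of `S(t) + i t`, which exists for almost every `t`. -/
def errorIntegrand (p : ℕ) (f : ℂ → ℂ) (S : ℝ → ℝ) (φ : ℝ → ℂ) (t : ℝ) : ℂ :=
  pairing (fun ε => tubularZeta p f ε (screenPoint S t)) φ * (((deriv S t : ℝ) : ℂ) + I)

/-- The distributional error term `(2πi)⁻¹ ∫_S p⁻¹ ζ(s) ε ^ (1 - s) / (1 - s) ds`, applied
to `φ`. -/
def errorTerm (p : ℕ) (f : ℂ → ℂ) (S : ℝ → ℝ) (φ : ℝ → ℂ) : ℂ :=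
  (2 * Real.pi * I)⁻¹ * ∫ t : ℝ, errorIntegrand p f S φ t

/-- The rescaled test function `φ_a(ε) = a⁻¹ φ(ε / a)`. -/
def dilate (φ : ℝ → ℂ) (a : ℝ) (ε : ℝ) : ℂ := (a : ℂ)⁻¹ * φ (ε / a)

/-- The space of test functions: smooth complex-valued functions on the line with compact support
contained in the open set `O`. -/
structure IsTestFunction (O : Set ℝ) (φ : ℝ → ℂ) : Prop where
  smooth : ContDiff ℝ (⊤ : ℕ∞) φ
  compact : HasCompactSupport φ
  support : tsupport φ ⊆ O

end

end PadicString

open PadicString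

/-!
Tested against `φ`, the two sides of the tube formula are the two ends of a contour shift.

Off the spheres that make up the metric boundary, every point of a component of length `l` has
distance exactly `l` to the metric boundary, so that the thin tube is the union of the open balls of
radius `l` in the components with `l < ε` (`thinTube_eq_iUnion`). Hence
`V(ε) = p⁻¹ ∑_{l < ε} l`, and integrated against `φ` this is `p⁻¹ ∑ l ∫_l^∞ φ`. Mellin inversion of
the tail integral `x ↦ ∫_x^∞ φ`, whose Mellin transform at `1 - s` is
`testTransform φ s = ∫ ε ^ (1 - s) φ(ε) dε / (1 - s)`, turns the sum into the integral of
`(2πi)⁻¹ p⁻¹ ζ(s) * testTransform φ s` along a vertical line `Re s = c` with `σ < c < 1`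
(`pairing_tubeVolume_eq`).

This line is moved to the screen. Between the heights `T (-n)` and `T n` the difference of the two
integrals, up to the two horizontal sides, is a sum of residues (`boundaryIntegral_eq_sum_residue`).
The screen is merely Lipschitz; the integrals along it are evaluated with primitives, by the
fundamental theorem of calculus for absolutely continuous functions. Cauchy's theorem then follows
because the boundary integral is locally constant in the upper height, and the residue theorem by
subtracting principal parts, the winding number being computed with two branches of the logarithm.
Fubini's theorem on a small circle around each pole identifies the residue of
`p⁻¹ ζ(s) * testTransform φ s` with the residue term integrated against `φ`
(`pairing_residueTerm`). The function `testTransform φ` decays faster than any power of `Im s`,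
while `ζ` grows at most like a power at the heights `T n` and along the screen: the horizontal sides
tend to `0`, the integral along the screen converges absolutely, and `tendsto_truncatedSum` results.

Dilating `φ` by `a` multiplies `testTransform φ s` by `a ^ (1 - s)`, which gives the size of the
error term (`isBigO_errorTerm_dilate`). If `φ` vanishes beyond `a < A⁻¹`, then `testTransform φ s`
is `O(a ^ (-Re s))`, so that the error term of the screen `S_m` is `O((A a) ^ (-sup S_m))`, which
tends to `0` (`tendsto_errorTerm_zero`). If the real parts of the poles are bounded below, all far
windows contain the same poles, and the error terms, being eventually constant, vanish.
-/

namespace PadicString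

/-! ### Integrals of holomorphic functions along Lipschitz curves -/

/-- The fundamental theorem of calculus for a Lipschitz path in `ℂ` that is differentiable almost
everywhere, from the real-valued version for absolutely continuous functions. -/
theorem integral_eq_sub_of_lipschitzOnWith {F F' : ℝ → ℂ} {a b : ℝ} {K : ℝ≥0}
    (hF : LipschitzOnWith K F (uIcc a b))
    (hd : ∀ᵐ t, t ∈ uIcc a b → HasDerivAt F (F' t) t) :
    ∫ t in a..b, F' t = F b - F a := by
  have key : ∀ L : ℂ →L[ℝ] ℝ, IntervalIntegrable (fun t => L (F' t)) volume a b ∧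
      ∫ t in a..b, L (F' t) = L (F b) - L (F a) := by
    intro L
    have hL := (L.lipschitz.comp_lipschitzOnWith hF).absolutelyContinuousOnInterval
    have hae : ∀ᵐ t, t ∈ uIoc a b → deriv (L ∘ F) t = L (F' t) := by
      filter_upwards [hd] with t ht hm
      exact (L.hasFDerivAt.comp_hasDerivAt t (ht (uIoc_subset_uIcc hm))).deriv
    refine ⟨hL.intervalIntegrable_deriv.congr_ae ?_, ?_⟩
    · rw [Filter.EventuallyEq, ae_restrict_iff' measurableSet_uIoc]
      exact hae
    · rw [← intervalIntegral.integral_congr_ae hae, hL.integral_deriv_eq_sub]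
      rfl
  obtain ⟨hr, hr'⟩ := key reCLM
  obtain ⟨hi, hi'⟩ := key imCLM
  have hr1 : IntervalIntegrable (fun t => ((reCLM (F' t) : ℝ) : ℂ)) volume a b :=
    ⟨hr.1.ofReal, hr.2.ofReal⟩
  have hi1 : IntervalIntegrable (fun t => ((imCLM (F' t) : ℝ) : ℂ)) volume a b :=
    ⟨hi.1.ofReal, hi.2.ofReal⟩
  have e : ∀ t, F' t = ((reCLM (F' t) : ℝ) : ℂ) + ((imCLM (F' t) : ℝ) : ℂ) * I := by
    intro t
    simp [re_add_im]
  rw [intervalIntegral.integral_congr fun t _ => e t,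
    intervalIntegral.integral_add hr1 (hi1.mul_const I),
    intervalIntegral.integral_mul_const, intervalIntegral.integral_ofReal,
    intervalIntegral.integral_ofReal, hr', hi']
  apply Complex.ext <;> simp

/-- The integral of `g` along a Lipschitz curve `γ` near which `g` has the primitive `G`. -/
theorem integral_comp_mul_deriv_of_primitive {γ γ' : ℝ → ℂ} {K : ℝ≥0} (hγ : LipschitzWith K γ)
    (hd : ∀ᵐ t, HasDerivAt γ (γ' t) t) {a b : ℝ} {G g : ℂ → ℂ}
    (hG : ∀ t ∈ uIcc a b, ∀ᶠ z in 𝓝 (γ t), HasDerivAt G (g z) z) :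
    ∫ t in a..b, g (γ t) * γ' t = G (γ b) - G (γ a) := by
  have hl : LocallyLipschitzOn (uIcc a b) (G ∘ γ) := by
    intro t ht
    have han : AnalyticAt ℂ G (γ t) := by
      rw [Complex.analyticAt_iff_eventually_differentiableAt]
      exact (hG t ht).mono fun z hz => hz.differentiableAt
    obtain ⟨C, s, hs, hC⟩ := ((han.contDiffAt (n := 1)).restrict_scalars ℝ).exists_lipschitzOnWith
    refine ⟨C * K, γ ⁻¹' s, mem_nhdsWithin_of_mem_nhds (hγ.continuous.continuousAt hs), ?_⟩
    exact hC.comp (hγ.lipschitzOnWith) (mapsTo_preimage _ _)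
  obtain ⟨C, hC⟩ := hl.exists_lipschitzOnWith_of_compact isCompact_uIcc
  refine integral_eq_sub_of_lipschitzOnWith (F := G ∘ γ) hC ?_
  filter_upwards [hd] with t ht hm
  exact (hG t hm).self_of_nhds.comp t ht

theorem integral_horizontal_of_primitive {G g : ℂ → ℂ} {a b y : ℝ}
    (hG : ∀ x ∈ uIcc a b, ∀ᶠ z in 𝓝 ((x : ℂ) + y * I), HasDerivAt G (g z) z) :
    ∫ x in a..b, g (x + y * I) = G (b + y * I) - G (a + y * I) := by
  have h := integral_comp_mul_deriv_of_primitive (γ := fun x : ℝ => (x : ℂ) + y * I)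
    (γ' := fun _ => 1) (K := 1) (LipschitzWith.of_dist_le_mul fun x x' => by
      rw [dist_eq_norm, add_sub_add_right_eq_sub, ← ofReal_sub, norm_real]
      simp [Real.dist_eq])
    (ae_of_all _ fun t => (ofRealCLM.hasDerivAt (x := t)).add_const _) hG
  simpa using h

theorem integral_vertical_of_primitive {G g : ℂ → ℂ} {a b x : ℝ}
    (hG : ∀ y ∈ uIcc a b, ∀ᶠ z in 𝓝 ((x : ℂ) + y * I), HasDerivAt G (g z) z) :
    (∫ y in a..b, g (x + y * I)) * I = G (x + b * I) - G (x + a * I) := by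
  have h := integral_comp_mul_deriv_of_primitive (γ := fun y : ℝ => (x : ℂ) + y * I)
    (γ' := fun _ => I) (K := 1) (LipschitzWith.of_dist_le_mul fun y y' => by
      rw [dist_eq_norm, add_sub_add_left_eq_sub, ← sub_mul, ← ofReal_sub, norm_mul, norm_real]
      simp [Real.dist_eq])
    (ae_of_all _ fun t => by
      simpa using ((ofRealCLM.hasDerivAt (x := t)).mul_const I).const_add (x : ℂ)) hG
  simpa using h

theorem lipschitzWith_screenPoint {S : ℝ → ℝ} {K : ℝ≥0} (hS : LipschitzWith K S) :
    LipschitzWith (K + 1) (screenPoint S) := by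
  refine LipschitzWith.of_dist_le_mul fun x y => ?_
  have h1 := hS.dist_le_mul x y
  rw [Real.dist_eq] at h1
  have e : screenPoint S x - screenPoint S y = ((S x - S y : ℝ) : ℂ) + ((x - y : ℝ) : ℂ) * I := by
    simp only [screenPoint]; push_cast; ring
  rw [dist_eq_norm, e]
  refine (norm_add_le _ _).trans ?_
  rw [norm_mul, norm_I, norm_real, norm_real, Real.norm_eq_abs, Real.norm_eq_abs]
  rw [Real.dist_eq] at h1 ⊢
  push_cast
  linarith

theorem ae_hasDerivAt_screenPoint {S : ℝ → ℝ} {K : ℝ≥0} (hS : LipschitzWith K S) :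
    ∀ᵐ t, HasDerivAt (screenPoint S) (((deriv S t : ℝ) : ℂ) + I) t := by
  filter_upwards [hS.ae_differentiableAt_real] with t ht
  have h1 := ht.hasDerivAt.ofReal_comp
  have h2 : HasDerivAt (fun t : ℝ => (t : ℂ) * I) I t := by
    simpa using (ofRealCLM.hasDerivAt (x := t)).mul_const I
  exact h1.add h2

theorem integral_screen_of_primitive {S : ℝ → ℝ} {K : ℝ≥0} (hS : LipschitzWith K S)
    {G g : ℂ → ℂ} {a b : ℝ}
    (hG : ∀ t ∈ uIcc a b, ∀ᶠ z in 𝓝 (screenPoint S t), HasDerivAt G (g z) z) :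
    ∫ t in a..b, g (screenPoint S t) * (((deriv S t : ℝ) : ℂ) + I) =
      G (screenPoint S b) - G (screenPoint S a) :=
  integral_comp_mul_deriv_of_primitive (lipschitzWith_screenPoint hS)
    (ae_hasDerivAt_screenPoint hS) hG

theorem measurable_screenDeriv (S : ℝ → ℝ) :
    Measurable fun t : ℝ => ((deriv S t : ℝ) : ℂ) + I :=
  (measurable_ofReal.comp (measurable_deriv S)).add_const I

theorem norm_screenDeriv_le {S : ℝ → ℝ} {K : ℝ≥0} (hS : LipschitzWith K S) (t : ℝ) :
    ‖((deriv S t : ℝ) : ℂ) + I‖ ≤ K + 1 := by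
  refine (norm_add_le _ _).trans ?_
  rw [norm_I, norm_real]
  have := norm_deriv_le_of_lipschitz (x₀ := t) hS
  linarith

theorem intervalIntegrable_screen {S : ℝ → ℝ} {K : ℝ≥0} (hS : LipschitzWith K S) {g : ℂ → ℂ}
    {a b : ℝ} (hg : ∀ t ∈ uIcc a b, ContinuousAt g (screenPoint S t)) :
    IntervalIntegrable (fun t => g (screenPoint S t) * (((deriv S t : ℝ) : ℂ) + I))
      volume a b := by
  refine IntervalIntegrable.continuousOn_mul ?_ fun t ht =>
    ((hg t ht).comp (lipschitzWith_screenPoint hS).continuous.continuousAt).continuousWithinAt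
  refine (intervalIntegrable_const (c := (K + 1 : ℝ))).mono_fun
    (measurable_screenDeriv S).aestronglyMeasurable (ae_of_all _ fun t => ?_)
  refine (norm_screenDeriv_le hS t).trans ?_
  exact le_abs_self _

/-! ### Cauchy's theorem to the right of a screen -/

/-- The integral of `g` over the positively oriented boundary of the region
`{z | a ≤ z.im ≤ b, S z.im ≤ z.re ≤ c}`: the lower side, the right side, the upper side and the
screen, in this order. -/
noncomputable def boundaryIntegral (S : ℝ → ℝ) (a b c : ℝ) (g : ℂ → ℂ) : ℂ :=
  (∫ u in S a..c, g (u + a * I)) + (∫ t in a..b, g (c + t * I)) * I -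
    (∫ u in S b..c, g (u + b * I)) -
    ∫ t in a..b, g (screenPoint S t) * (((deriv S t : ℝ) : ℂ) + I)

/-- Cauchy's theorem for a region between the heights `a` and `t`, when `t` is close to `a`: the
screen then stays in a disc around `S a + i a` on which `h` has a primitive, so that it may be
replaced by a vertical segment. -/
theorem eventually_boundaryIntegral_eq_zero {S : ℝ → ℝ} {K : ℝ≥0} (hS : LipschitzWith K S)
    {c a : ℝ} {h : ℂ → ℂ} (hh : ∀ u ∈ uIcc (S a) c, AnalyticAt ℂ h (u + a * I)) :
    ∀ᶠ t in 𝓝 a, boundaryIntegral S a t c h = 0 := by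
  have hopen : IsOpen {z | AnalyticAt ℂ h z} := isOpen_analyticAt ℂ h
  have hcont : Continuous fun q : ℝ × ℝ => (q.2 : ℂ) + q.1 * I := by fun_prop
  have htube : ∀ᶠ t : ℝ in 𝓝 a, ∀ u ∈ uIcc (S a) c, AnalyticAt ℂ h (u + t * I) :=
    isCompact_uIcc.eventually_forall_of_forall_eventually fun u hu =>
      (hcont.tendsto (a, u)).eventually (hopen.mem_nhds (hh u hu))
  have hP : {z | AnalyticAt ℂ h z} ∈ 𝓝 ((S a : ℂ) + a * I) :=
    hopen.mem_nhds (hh _ left_mem_uIcc)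
  obtain ⟨r, hr, hball⟩ := Metric.mem_nhds_iff.1 hP
  have hdiff : DifferentiableOn ℂ h (Metric.ball ((S a : ℂ) + a * I) r) := fun z hz =>
    (hball hz).differentiableAt.differentiableWithinAt
  obtain ⟨H, hH⟩ := hdiff.isExactOn_ball
  have hSa : ∀ᶠ t in 𝓝 a, |S t - S a| < r / 2 := by
    have := hS.continuous.continuousAt (x := a)
    filter_upwards [this.eventually (Metric.ball_mem_nhds _ (half_pos hr))] with t ht
    simpa [Real.dist_eq] using ht
  obtain ⟨δ, hδ, hev⟩ := Metric.eventually_nhds_iff_ball.1 (htube.and hSa)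
  have hmem : ∀ u t : ℝ, |u - S a| < r / 2 → |t - a| < r / 2 →
      (u : ℂ) + t * I ∈ Metric.ball ((S a : ℂ) + a * I) r := by
    intro u t hu ht
    have e : (u : ℂ) + t * I - ((S a : ℂ) + a * I) =
        ((u - S a : ℝ) : ℂ) + ((t - a : ℝ) : ℂ) * I := by
      push_cast; ring
    rw [mem_ball_iff_norm, e]
    refine (norm_add_le _ _).trans_lt ?_
    rw [norm_mul, norm_I, norm_real, norm_real, Real.norm_eq_abs, Real.norm_eq_abs]
    linarith
  have hprim : ∀ u t : ℝ, |u - S a| < r / 2 → |t - a| < r / 2 →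
      ∀ᶠ z in 𝓝 ((u : ℂ) + t * I), HasDerivAt H (h z) z := fun u t hu ht =>
    Filter.mem_of_superset (Metric.isOpen_ball.mem_nhds (hmem u t hu ht)) fun z hz => hH z hz
  filter_upwards [Metric.ball_mem_nhds a (lt_min hδ (half_pos hr))] with t ht
  have hbt : ∀ τ ∈ uIcc a t, |τ - a| < min δ (r / 2) := by
    intro τ hτ
    rw [Metric.mem_ball, Real.dist_eq] at ht
    exact (abs_sub_left_of_mem_uIcc hτ).trans_lt ht
  have hball' : ∀ τ ∈ uIcc a t, τ ∈ Metric.ball a δ := fun τ hτ => by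
    rw [Metric.mem_ball, Real.dist_eq]; exact (hbt τ hτ).trans_le (min_le_left _ _)
  have hτr : ∀ τ ∈ uIcc a t, |τ - a| < r / 2 := fun τ hτ => (hbt τ hτ).trans_le (min_le_right _ _)
  have hSt : ∀ u ∈ uIcc (S a) (S t), |u - S a| < r / 2 := fun u hu =>
    (abs_sub_left_of_mem_uIcc hu).trans_lt (hev t (hball' t right_mem_uIcc)).2
  -- near the screen, `H` is a primitive; what it leaves over is the boundary of the rectangle with
  -- opposite corners `S a + i a` and `c + i t`
  have e1 := integral_horizontal_of_primitive (G := H) (g := h) (a := S a) (b := S t) (y := t)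
    fun u hu => hprim u t (hSt u hu) (hτr t right_mem_uIcc)
  have e2 := integral_vertical_of_primitive (G := H) (g := h) (a := a) (b := t) (x := S a)
    fun τ hτ => hprim (S a) τ (by simpa using half_pos hr) (hτr τ hτ)
  have e3 := integral_screen_of_primitive (G := H) (g := h) (a := a) (b := t) hS
    fun τ hτ => hprim (S τ) τ (hev τ (hball' τ hτ)).2 (hτr τ hτ)
  have e4 := Complex.integral_boundary_rect_eq_zero_of_differentiableOn h ((S a : ℂ) + a * I)
    ((c : ℂ) + t * I) (by
      intro z hz
      obtain ⟨hz1, hz2⟩ := hz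
      simp only [mem_preimage, add_re, ofReal_re, mul_re, I_re, mul_zero, ofReal_im, I_im,
        sub_self, add_zero, add_im, mul_im, mul_one, zero_add] at hz1 hz2
      have := (hev z.im (hball' _ hz2)).1 z.re hz1
      rw [re_add_im] at this
      exact this.differentiableAt.differentiableWithinAt)
  simp only [add_re, ofReal_re, mul_re, I_re, mul_zero, ofReal_im, I_im,
        sub_self, add_zero, add_im, mul_im, mul_one, zero_add, smul_eq_mul] at e4
  have hi1 : IntervalIntegrable (fun u : ℝ => h (u + t * I)) volume (S a) (S t) := by
    refine ContinuousOn.intervalIntegrable fun u hu => ContinuousAt.continuousWithinAt ?_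
    exact ContinuousAt.comp (f := fun u : ℝ => (u : ℂ) + t * I)
      (hball (hmem u t (hSt u hu) (hτr t right_mem_uIcc))).continuousAt (by fun_prop)
  have hi2 : IntervalIntegrable (fun u : ℝ => h (u + t * I)) volume (S a) c := by
    refine ContinuousOn.intervalIntegrable fun u hu => ContinuousAt.continuousWithinAt ?_
    exact ContinuousAt.comp (f := fun u : ℝ => (u : ℂ) + t * I)
      ((hev t (hball' t right_mem_uIcc)).1 u hu).continuousAt (by fun_prop)
  have e5 := intervalIntegral.integral_add_adjacent_intervals hi1.symm hi2
  rw [intervalIntegral.integral_symm] at e5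
  simp only [boundaryIntegral]
  rw [e3, ← e5, e1]
  simp only [screenPoint]
  linear_combination e4 + e2

/-- Cauchy's theorem for the region to the right of a screen: as a function of the upper height, the
boundary integral is locally constant. -/
theorem boundaryIntegral_eq_zero_of_analyticAt {S : ℝ → ℝ} {K : ℝ≥0} (hS : LipschitzWith K S)
    {a b c : ℝ} (hab : a ≤ b) (hc : ∀ t ∈ Icc a b, S t ≤ c) {h : ℂ → ℂ}
    (hh : ∀ z : ℂ, z.im ∈ Icc a b → z.re ∈ Icc (S z.im) c → AnalyticAt ℂ h z) :
    boundaryIntegral S a b c h = 0 := by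
  have hh' : ∀ u t : ℝ, t ∈ Icc a b → u ∈ Icc (S t) c → AnalyticAt ℂ h (u + t * I) :=
    fun u t ht hu => hh _ (by simpa using ht) (by simpa using hu)
  have hi1 : IntervalIntegrable (fun t : ℝ => h (c + t * I)) volume a b := by
    refine ContinuousOn.intervalIntegrable fun t ht => ContinuousAt.continuousWithinAt ?_
    rw [uIcc_of_le hab] at ht
    exact ContinuousAt.comp (f := fun t : ℝ => (c : ℂ) + t * I)
      (hh' c t ht ⟨hc t ht, le_rfl⟩).continuousAt (by fun_prop)
  have hi2 := intervalIntegrable_screen hS (g := h) (a := a) (b := b) fun t ht => by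
    rw [uIcc_of_le hab] at ht
    exact (hh' (S t) t ht ⟨le_rfl, hc t ht⟩).continuousAt
  have hloc : ∀ t₀ ∈ Icc a b, ∀ᶠ t in 𝓝[Icc a b] t₀,
      boundaryIntegral S a t c h = boundaryIntegral S a t₀ c h := by
    intro t₀ ht₀
    have := eventually_boundaryIntegral_eq_zero hS (c := c) (a := t₀) (h := h) fun u hu => by
      rw [uIcc_of_le (hc t₀ ht₀)] at hu
      exact hh' u t₀ ht₀ hu
    filter_upwards [mem_nhdsWithin_of_mem_nhds this, self_mem_nhdsWithin] with t ht htm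
    have sub1 : uIcc a t₀ ⊆ uIcc a b := uIcc_subset_uIcc_left (by rwa [uIcc_of_le hab])
    have sub2 : uIcc t₀ t ⊆ uIcc a b :=
      uIcc_subset_uIcc (by rwa [uIcc_of_le hab]) (by rwa [uIcc_of_le hab])
    have a1 := intervalIntegral.integral_add_adjacent_intervals (hi1.mono_set sub1)
      (hi1.mono_set sub2)
    have a2 := intervalIntegral.integral_add_adjacent_intervals (hi2.mono_set sub1)
      (hi2.mono_set sub2)
    simp only [boundaryIntegral] at ht ⊢
    rw [← a1, ← a2]
    linear_combination ht
  have hder : ∀ t₀ ∈ Icc a b,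
      HasDerivWithinAt (fun t => boundaryIntegral S a t c h) 0 (Icc a b) t₀ := fun t₀ ht₀ =>
    (hasDerivWithinAt_const t₀ (Icc a b) (boundaryIntegral S a t₀ c h)).congr_of_eventuallyEq
      (hloc t₀ ht₀) rfl
  rcases hab.eq_or_lt with rfl | hlt
  · simp [boundaryIntegral]
  have := constant_of_derivWithin_zero (fun t ht => (hder t ht).differentiableWithinAt)
    (fun t ht => (hder t (Ico_subset_Icc_self ht)).derivWithin
      (uniqueDiffOn_Icc hlt t (Ico_subset_Icc_self ht))) b (right_mem_Icc.2 hab)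
  rw [this]
  simp [boundaryIntegral]

/-! ### Residues -/

/-- `g` has a Laurent expansion at `w` with principal part `∑ₖ a k / (z - w) ^ (k + 1)`,
`k ≤ N`, and analytic part `h`. -/
structure HasLaurentExpansion (g : ℂ → ℂ) (w : ℂ) (N : ℕ) (a : ℕ → ℂ) (h : ℂ → ℂ) : Prop where
  analyticAt : AnalyticAt ℂ h w
  eq : ∀ᶠ z in 𝓝[≠] w, g z = ∑ k ∈ Finset.range (N + 1), a k * ((z - w) ^ (k + 1))⁻¹ + h z

theorem exists_laurent_of_analyticAt {w : ℂ} (n : ℕ) : ∀ h : ℂ → ℂ, AnalyticAt ℂ h w →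
    ∃ (a : ℕ → ℂ) (h₂ : ℂ → ℂ), AnalyticAt ℂ h₂ w ∧ ∀ᶠ z in 𝓝[≠] w,
      ((z - w) ^ n)⁻¹ * h z = ∑ k ∈ Finset.range n, a k * ((z - w) ^ (k + 1))⁻¹ + h₂ z := by
  induction n with
  | zero => exact fun h hh => ⟨0, h, hh, by simp⟩
  | succ n ih =>
    intro h hh
    obtain ⟨p, hp⟩ := hh
    have hd : AnalyticAt ℂ (dslope h w) w := (hp.has_fpower_series_dslope_fslope).analyticAt
    obtain ⟨a, h₂, hh₂, he⟩ := ih (dslope h w) hd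
    refine ⟨Function.update a n (h w), h₂, hh₂, ?_⟩
    filter_upwards [he, self_mem_nhdsWithin] with z hz hzw
    have hne : z - w ≠ 0 := sub_ne_zero.2 hzw
    have hs : ∑ k ∈ Finset.range n, Function.update a n (h w) k * ((z - w) ^ (k + 1))⁻¹ =
        ∑ k ∈ Finset.range n, a k * ((z - w) ^ (k + 1))⁻¹ :=
      Finset.sum_congr rfl fun k hk => by
        rw [Function.update_of_ne (Finset.mem_range.1 hk).ne]
    rw [Finset.sum_range_succ, hs, Function.update_self, add_right_comm, ← hz,
      dslope_of_ne _ hzw, slope_def_field]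
    field_simp
    ring

theorem exists_hasLaurentExpansion {g : ℂ → ℂ} {w : ℂ} (hg : MeromorphicAt g w) :
    ∃ N a h, HasLaurentExpansion g w N a h := by
  obtain ⟨n, hn⟩ := hg
  have hn' : AnalyticAt ℂ (fun z => (z - w) * ((z - w) ^ n • g z)) w :=
    (analyticAt_id.sub analyticAt_const).mul hn
  obtain ⟨a, h, hh, he⟩ := exists_laurent_of_analyticAt (n + 1) _ hn'
  refine ⟨n, a, h, hh, ?_⟩
  filter_upwards [he, self_mem_nhdsWithin] with z hz hzw
  have hne : z - w ≠ 0 := sub_ne_zero.2 hzw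
  rw [← hz, smul_eq_mul]
  field_simp
  ring

theorem circleIntegral_eq_of_punctured {g : ℂ → ℂ} {w : ℂ} {ρ r : ℝ} (hr : 0 < r) (hrρ : r ≤ ρ)
    (hg : ∀ z ∈ Metric.closedBall w ρ, z ≠ w → AnalyticAt ℂ g z) :
    (∮ z in C(w, ρ), g z) = ∮ z in C(w, r), g z := by
  have hz : ∀ z ∈ Metric.closedBall w ρ \ Metric.ball w r, AnalyticAt ℂ g z := fun z hz =>
    hg z hz.1 fun h => hz.2 (h ▸ Metric.mem_ball_self hr)
  exact Complex.circleIntegral_eq_of_differentiable_on_annulus_off_countable hr hrρ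
    countable_empty (fun z h => (hz z h).continuousAt.continuousWithinAt)
    fun z h => (hz z ⟨Metric.ball_subset_closedBall h.1.1, fun h' =>
      h.1.2 (Metric.ball_subset_closedBall h')⟩).differentiableAt

theorem residue_eq_circleIntegral {g : ℂ → ℂ} {w : ℂ} {ρ : ℝ} (hρ : 0 < ρ)
    (hg : ∀ z ∈ Metric.closedBall w ρ, z ≠ w → AnalyticAt ℂ g z) :
    residue g w = (2 * Real.pi * I)⁻¹ * ∮ z in C(w, ρ), g z := by
  refine Tendsto.limUnder_eq (tendsto_const_nhds.congr' ?_)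
  filter_upwards [Ioc_mem_nhdsGT hρ] with r hr
  rw [circleIntegral_eq_of_punctured hr.1 hr.2 hg]

theorem HasLaurentExpansion.residue_eq {g : ℂ → ℂ} {w : ℂ} {N : ℕ} {a : ℕ → ℂ} {h : ℂ → ℂ}
    (H : HasLaurentExpansion g w N a h) : residue g w = a 0 := by
  refine Tendsto.limUnder_eq (tendsto_const_nhds.congr' ?_)
  have h1 := H.eq
  rw [eventually_nhdsWithin_iff] at h1
  obtain ⟨ρ, hρ, hb⟩ := Metric.eventually_nhds_iff_ball.1
    (h1.and H.analyticAt.eventually_analyticAt)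
  filter_upwards [Ioo_mem_nhdsGT hρ] with r hr
  have hsub : Metric.closedBall w r ⊆ Metric.ball w ρ := Metric.closedBall_subset_ball hr.2
  have hne : ∀ z ∈ Metric.sphere w r, z - w ≠ 0 := fun z hz h0 => by
    rw [mem_sphere_iff_norm, h0, norm_zero] at hz
    exact hr.1.ne hz
  have e1 : (∮ z in C(w, r), g z) =
      ∮ z in C(w, r), (∑ k ∈ Finset.range (N + 1), a k * ((z - w) ^ (k + 1))⁻¹ + h z) :=
    circleIntegral.integral_congr hr.1.le fun z hz =>
      (hb z (hsub (Metric.sphere_subset_closedBall hz))).1 (sub_ne_zero.1 (hne z hz))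
  have hint : ∀ k ∈ Finset.range (N + 1),
      CircleIntegrable (fun z => a k * ((z - w) ^ (k + 1))⁻¹) w r := fun k _ =>
    ContinuousOn.circleIntegrable hr.1.le (continuousOn_const.mul
      (ContinuousOn.inv₀ (by fun_prop) fun z hz => pow_ne_zero _ (hne z hz)))
  have hh : CircleIntegrable h w r := ContinuousOn.circleIntegrable hr.1.le fun z hz =>
    (hb z (hsub (Metric.sphere_subset_closedBall hz))).2.continuousAt.continuousWithinAt
  have h0 : (∮ z in C(w, r), h z) = 0 :=
    Complex.circleIntegral_eq_zero_of_differentiable_on_off_countable hr.1.le countable_empty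
      (fun z hz => (hb z (hsub hz)).2.continuousAt.continuousWithinAt)
      fun z hz => (hb z (hsub (Metric.ball_subset_closedBall hz.1))).2.differentiableAt
  have hs : (∮ z in C(w, r), ∑ k ∈ Finset.range (N + 1), a k * ((z - w) ^ (k + 1))⁻¹) =
      a 0 * (2 * Real.pi * I) := by
    rw [circleIntegral.integral_fun_sum hint, Finset.sum_range_succ', Finset.sum_eq_zero]
    · simp [circleIntegral.integral_sub_center_inv w hr.1.ne']
    · intro k _
      rw [circleIntegral.integral_const_mul]
      have := circleIntegral.integral_sub_zpow_of_ne (n := -((k + 1 + 1 : ℕ) : ℤ)) (by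
        push_cast; omega) w w r
      simp only [zpow_neg, zpow_natCast] at this
      rw [this, mul_zero]
  rw [e1, circleIntegral.integral_add (CircleIntegrable.fun_sum _ hint) hh, h0, hs]
  have : (2 * Real.pi * I : ℂ) ≠ 0 := by simp [Real.pi_ne_zero]
  field_simp
  ring

/-! ### The residue theorem to the right of a screen -/

/-- The edges of the region `{z | a ≤ z.im ≤ b, S z.im ≤ z.re ≤ c}`. -/
def regionEdges (S : ℝ → ℝ) (a b c : ℝ) : Set ℂ :=
  {z | (z.im ∈ Icc a b ∧ z.re ∈ Icc (S z.im) c) ∧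
    (z.im = a ∨ z.im = b ∨ z.re = c ∨ z.re = S z.im)}

theorem lowerEdge_mem {S : ℝ → ℝ} {a b c : ℝ} (hab : a ≤ b)
    (hc : ∀ t ∈ Icc a b, S t ≤ c) {u : ℝ} (hu : u ∈ uIcc (S a) c) :
    (u : ℂ) + a * I ∈ regionEdges S a b c := by
  rw [uIcc_of_le (hc a ⟨le_rfl, hab⟩)] at hu
  simpa [regionEdges, hab] using hu

theorem upperEdge_mem {S : ℝ → ℝ} {a b c : ℝ} (hab : a ≤ b)
    (hc : ∀ t ∈ Icc a b, S t ≤ c) {u : ℝ} (hu : u ∈ uIcc (S b) c) :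
    (u : ℂ) + b * I ∈ regionEdges S a b c := by
  rw [uIcc_of_le (hc b ⟨hab, le_rfl⟩)] at hu
  simpa [regionEdges, hab] using hu

theorem rightEdge_mem {S : ℝ → ℝ} {a b c : ℝ} (hab : a ≤ b)
    (hc : ∀ t ∈ Icc a b, S t ≤ c) {t : ℝ} (ht : t ∈ uIcc a b) :
    (c : ℂ) + t * I ∈ regionEdges S a b c := by
  rw [uIcc_of_le hab] at ht
  have := hc t ht
  simpa [regionEdges, this] using ht

theorem screenEdge_mem {S : ℝ → ℝ} {a b c : ℝ} (hab : a ≤ b)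
    (hc : ∀ t ∈ Icc a b, S t ≤ c) {t : ℝ} (ht : t ∈ uIcc a b) :
    screenPoint S t ∈ regionEdges S a b c := by
  rw [uIcc_of_le hab] at ht
  have := hc t ht
  simpa [regionEdges, screenPoint, this] using ht

theorem boundaryIntegral_congr {S : ℝ → ℝ} {a b c : ℝ} (hab : a ≤ b)
    (hc : ∀ t ∈ Icc a b, S t ≤ c) {g₁ g₂ : ℂ → ℂ} (h : EqOn g₁ g₂ (regionEdges S a b c)) :
    boundaryIntegral S a b c g₁ = boundaryIntegral S a b c g₂ := by
  unfold boundaryIntegral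
  congr 1
  · congr 1
    · congr 1
      · exact intervalIntegral.integral_congr fun u hu => h (lowerEdge_mem hab hc hu)
      · congr 1
        exact intervalIntegral.integral_congr fun u hu => h (rightEdge_mem hab hc hu)
    · exact intervalIntegral.integral_congr fun u hu => h (upperEdge_mem hab hc hu)
  · refine intervalIntegral.integral_congr fun u hu => ?_
    simp only [h (screenEdge_mem hab hc hu)]

theorem intervalIntegrable_horizontal {g : ℂ → ℂ} {a b y : ℝ}
    (hg : ∀ x ∈ uIcc a b, ContinuousAt g ((x : ℂ) + y * I)) :
    IntervalIntegrable (fun x : ℝ => g (x + y * I)) volume a b :=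
  ContinuousOn.intervalIntegrable fun x hx => ContinuousAt.continuousWithinAt
    (ContinuousAt.comp (f := fun x : ℝ => (x : ℂ) + y * I) (hg x hx) (by fun_prop))

theorem intervalIntegrable_vertical {g : ℂ → ℂ} {a b x : ℝ}
    (hg : ∀ y ∈ uIcc a b, ContinuousAt g ((x : ℂ) + y * I)) :
    IntervalIntegrable (fun y : ℝ => g (x + y * I)) volume a b :=
  ContinuousOn.intervalIntegrable fun y hy => ContinuousAt.continuousWithinAt
    (ContinuousAt.comp (f := fun y : ℝ => (x : ℂ) + y * I) (hg y hy) (by fun_prop))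

theorem boundaryIntegral_add {S : ℝ → ℝ} {K : ℝ≥0} (hS : LipschitzWith K S) {a b c : ℝ}
    (hab : a ≤ b) (hc : ∀ t ∈ Icc a b, S t ≤ c) {g₁ g₂ : ℂ → ℂ}
    (h₁ : ∀ z ∈ regionEdges S a b c, ContinuousAt g₁ z)
    (h₂ : ∀ z ∈ regionEdges S a b c, ContinuousAt g₂ z) :
    boundaryIntegral S a b c (fun z => g₁ z + g₂ z) =
      boundaryIntegral S a b c g₁ + boundaryIntegral S a b c g₂ := by
  unfold boundaryIntegral
  simp only [add_mul]
  rw [intervalIntegral.integral_add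
      (intervalIntegrable_horizontal fun x hx => h₁ _ (lowerEdge_mem hab hc hx))
      (intervalIntegrable_horizontal fun x hx => h₂ _ (lowerEdge_mem hab hc hx)),
    intervalIntegral.integral_add
      (intervalIntegrable_horizontal fun x hx => h₁ _ (upperEdge_mem hab hc hx))
      (intervalIntegrable_horizontal fun x hx => h₂ _ (upperEdge_mem hab hc hx)),
    intervalIntegral.integral_add
      (intervalIntegrable_vertical fun x hx => h₁ _ (rightEdge_mem hab hc hx))
      (intervalIntegrable_vertical fun x hx => h₂ _ (rightEdge_mem hab hc hx)),
    intervalIntegral.integral_add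
      (intervalIntegrable_screen hS fun x hx => h₁ _ (screenEdge_mem hab hc hx))
      (intervalIntegrable_screen hS fun x hx => h₂ _ (screenEdge_mem hab hc hx))]
  ring

theorem boundaryIntegral_const_mul (S : ℝ → ℝ) (a b c : ℝ) (A : ℂ) (g : ℂ → ℂ) :
    boundaryIntegral S a b c (fun z => A * g z) = A * boundaryIntegral S a b c g := by
  unfold boundaryIntegral
  simp only [mul_assoc, intervalIntegral.integral_const_mul]
  ring

theorem boundaryIntegral_eq_zero_of_primitive {S : ℝ → ℝ} {K : ℝ≥0} (hS : LipschitzWith K S)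
    {a b c : ℝ} (hab : a ≤ b) (hc : ∀ t ∈ Icc a b, S t ≤ c) {G g : ℂ → ℂ}
    (hG : ∀ z ∈ regionEdges S a b c, ∀ᶠ z' in 𝓝 z, HasDerivAt G (g z') z') :
    boundaryIntegral S a b c g = 0 := by
  unfold boundaryIntegral
  rw [integral_horizontal_of_primitive fun x hx => hG _ (lowerEdge_mem hab hc hx),
    integral_horizontal_of_primitive fun x hx => hG _ (upperEdge_mem hab hc hx),
    integral_vertical_of_primitive fun x hx => hG _ (rightEdge_mem hab hc hx),
    integral_screen_of_primitive hS fun x hx => hG _ (screenEdge_mem hab hc hx)]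
  simp only [screenPoint]
  ring

/-- The winding number of the boundary around a point of the interior is `1`: `log (w - z)` is a
primitive of `(z - w)⁻¹` along the screen, `log (z - w)` is one along the three other sides, and
at the upper and lower ends of the screen they differ by `-π i` and `π i`. -/
theorem boundaryIntegral_inv_sub {S : ℝ → ℝ} {K : ℝ≥0} (hS : LipschitzWith K S)
    {a b c : ℝ} {w : ℂ} (ha : a < w.im) (hb : w.im < b)
    (hSw : S w.im < w.re) (hwc : w.re < c) :
    boundaryIntegral S a b c (fun z => (z - w)⁻¹) = 2 * Real.pi * I := by
  have hab : a ≤ b := (ha.trans hb).le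
  have hr : ∀ z : ℂ, z - w ∈ slitPlane →
      ∀ᶠ z' in 𝓝 z, HasDerivAt (fun z => log (z - w)) ((z' - w)⁻¹) z' := by
    intro z hz
    filter_upwards [(continuous_id.sub continuous_const).continuousAt.eventually
      (isOpen_slitPlane.mem_nhds hz)] with z' hz'
    simpa using ((hasDerivAt_id z').sub_const w).clog hz'
  have hl : ∀ z : ℂ, w - z ∈ slitPlane →
      ∀ᶠ z' in 𝓝 z, HasDerivAt (fun z => log (w - z)) ((z' - w)⁻¹) z' := by
    intro z hz
    filter_upwards [(continuous_const.sub continuous_id).continuousAt.eventually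
      (isOpen_slitPlane.mem_nhds hz)] with z' hz'
    have := ((hasDerivAt_id z').const_sub w).clog hz'
    have e : (z' - w)⁻¹ = -1 / (w - id z') := by
      rw [id, ← neg_sub w z', inv_neg, neg_div, one_div]
    rw [e]
    exact this
  unfold boundaryIntegral
  rw [integral_horizontal_of_primitive (G := fun z => log (z - w)) fun x hx => hr _
      (Or.inr (by simpa using (sub_neg.2 ha).ne)),
    integral_horizontal_of_primitive (G := fun z => log (z - w)) fun x hx => hr _
      (Or.inr (by simpa using (sub_pos.2 hb).ne')),
    integral_vertical_of_primitive (G := fun z => log (z - w)) fun x hx => hr _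
      (Or.inl (by simpa using hwc)),
    integral_screen_of_primitive (G := fun z => log (w - z)) hS fun t ht => hl _ (by
      rcases eq_or_ne t w.im with rfl | hne
      · exact Or.inl (by simpa [screenPoint] using hSw)
      · exact Or.inr (by
          simpa [screenPoint] using sub_ne_zero.2 hne.symm))]
  have h1 : log (w - screenPoint S b) = log (screenPoint S b - w) - Real.pi * I := by
    have him : 0 < (screenPoint S b - w).im := by simpa [screenPoint] using hb
    rw [← neg_sub, log, log, norm_neg, arg_neg_eq_arg_sub_pi_of_im_pos him]
    push_cast; ring
  have h2 : log (w - screenPoint S a) = log (screenPoint S a - w) + Real.pi * I := by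
    have him : (screenPoint S a - w).im < 0 := by simpa [screenPoint] using ha
    rw [← neg_sub, log, log, norm_neg, arg_neg_eq_arg_add_pi_of_im_neg him]
    push_cast; ring
  rw [h1, h2]
  simp only [screenPoint]
  ring

/-- The residue theorem for the region between a screen and a vertical line. The poles are removed
one at a time by subtracting principal parts. -/
theorem boundaryIntegral_eq_sum_residue {S : ℝ → ℝ} {K : ℝ≥0} (hS : LipschitzWith K S)
    {a b c : ℝ} (hab : a ≤ b) (hc : ∀ t ∈ Icc a b, S t ≤ c) (D : Finset ℂ) :
    ∀ g : ℂ → ℂ,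
      (∀ w ∈ D, a < w.im ∧ w.im < b ∧ S w.im < w.re ∧ w.re < c) →
      (∀ w ∈ D, MeromorphicAt g w) →
      (∀ z : ℂ, z.im ∈ Icc a b → z.re ∈ Icc (S z.im) c → z ∉ D → AnalyticAt ℂ g z) →
      boundaryIntegral S a b c g = 2 * Real.pi * I * ∑ w ∈ D, residue g w := by
  classical
  induction D using Finset.induction_on with
  | empty =>
    intro g _ _ hg
    rw [boundaryIntegral_eq_zero_of_analyticAt hS hab hc fun z h1 h2 => hg z h1 h2 (by simp)]
    simp
  | insert w D hwD ih =>
    intro g hD hm hg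
    obtain ⟨ha, hb, hSw, hwc⟩ := hD w (Finset.mem_insert_self w D)
    obtain ⟨N, α, h, hL⟩ := exists_hasLaurentExpansion (hm w (Finset.mem_insert_self w D))
    set P : ℂ → ℂ := fun z => ∑ k ∈ Finset.range (N + 1), α k * ((z - w) ^ (k + 1))⁻¹ with hP
    have hPan : ∀ z ≠ w, AnalyticAt ℂ P z := fun z hz =>
      Finset.analyticAt_fun_sum _ fun k _ => analyticAt_const.mul
        (((analyticAt_id.sub analyticAt_const).pow _).inv (pow_ne_zero _ (sub_ne_zero.2 hz)))
    set g' : ℂ → ℂ := fun z => if z = w then h w else g z - P z with hg'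
    have hg'w : g' =ᶠ[𝓝 w] h := by
      have := hL.eq
      rw [eventually_nhdsWithin_iff] at this
      filter_upwards [this] with z hz
      by_cases hzw : z = w
      · simp [hg', hzw]
      · simp only [hg', if_neg hzw, hz hzw, hP, add_sub_cancel_left]
    have hg'ne : ∀ z ≠ w, g' =ᶠ[𝓝 z] fun z => g z - P z := fun z hz => by
      filter_upwards [isOpen_ne.mem_nhds hz] with z' hz'
      exact if_neg hz'
    have hgan : ∀ z : ℂ, z.im ∈ Icc a b → z.re ∈ Icc (S z.im) c → z ∉ D → AnalyticAt ℂ g' z := by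
      intro z h1 h2 h3
      by_cases hzw : z = w
      · rw [hzw]
        exact hL.analyticAt.congr hg'w.symm
      · exact ((hg z h1 h2 (by simp [hzw, h3])).fun_sub (hPan z hzw)).congr (hg'ne z hzw).symm
    have hDne : ∀ v ∈ D, v ≠ w := fun v hv hvw => hwD (hvw ▸ hv)
    have hgm : ∀ v ∈ D, MeromorphicAt g' v := fun v hv =>
      ((hm v (Finset.mem_insert_of_mem hv)).fun_sub (hPan v (hDne v hv)).meromorphicAt).congr
        ((hg'ne v (hDne v hv)).symm.filter_mono nhdsWithin_le_nhds)
    have hIH := ih g' (fun v hv => hD v (Finset.mem_insert_of_mem hv)) hgm hgan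
    -- subtracting the principal part at `w` does not change the other residues
    have hres : ∀ v ∈ D, residue g' v = residue g v := by
      intro v hv
      obtain ⟨M, β, k, hk⟩ := exists_hasLaurentExpansion (hm v (Finset.mem_insert_of_mem hv))
      have : HasLaurentExpansion g' v M β (fun z => k z - P z) := by
        refine ⟨hk.analyticAt.fun_sub (hPan v (hDne v hv)), ?_⟩
        filter_upwards [hk.eq, (hg'ne v (hDne v hv)).filter_mono nhdsWithin_le_nhds] with z h1 h2
        rw [h2, h1]; ring
      rw [this.residue_eq, hk.residue_eq]
    have hEne : ∀ z ∈ regionEdges S a b c, z ≠ w := by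
      rintro z ⟨⟨h1, h2⟩, h3⟩ rfl
      rcases h3 with h3 | h3 | h3 | h3 <;> linarith
    have hEnD : ∀ z ∈ regionEdges S a b c, z ∉ D := by
      rintro z ⟨⟨h1, h2⟩, h3⟩ hz
      obtain ⟨q1, q2, q3, q4⟩ := hD z (Finset.mem_insert_of_mem hz)
      rcases h3 with h3 | h3 | h3 | h3 <;> linarith
    set Q : ℂ → ℂ := fun z => ∑ k ∈ Finset.range N, α (k + 1) * ((z - w) ^ (k + 2))⁻¹ with hQ
    have hQan : ∀ z ≠ w, AnalyticAt ℂ Q z := fun z hz =>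
      Finset.analyticAt_fun_sum _ fun k _ => analyticAt_const.mul
        (((analyticAt_id.sub analyticAt_const).pow _).inv (pow_ne_zero _ (sub_ne_zero.2 hz)))
    have hQ0 : boundaryIntegral S a b c Q = 0 := by
      refine boundaryIntegral_eq_zero_of_primitive hS hab hc (G := fun z =>
        ∑ k ∈ Finset.range N, α (k + 1) * (-((k : ℂ) + 1)⁻¹ * ((z - w) ^ (k + 1))⁻¹))
        fun z hz => ?_
      filter_upwards [isOpen_ne.mem_nhds (hEne z hz)] with z' hz'
      refine HasDerivAt.fun_sum fun k _ => HasDerivAt.const_mul _ ?_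
      have hne : z' - w ≠ 0 := sub_ne_zero.2 hz'
      have hk : (k : ℂ) + 1 ≠ 0 := Nat.cast_add_one_ne_zero k
      have h1 : HasDerivAt (fun z => (z - w) ^ (k + 1)) (((k + 1 : ℕ) : ℂ) * (z' - w) ^ k) z' := by
        simpa using ((hasDerivAt_id z').sub_const w).fun_pow (k + 1)
      refine ((h1.fun_inv (pow_ne_zero _ hne)).const_mul (-((k : ℂ) + 1)⁻¹)).congr_deriv ?_
      push_cast
      field_simp
      ring
    have hdecomp : EqOn g (fun z => g' z + (α 0 * (z - w)⁻¹ + Q z)) (regionEdges S a b c) := by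
      intro z hz
      simp only [hg', if_neg (hEne z hz), hP, hQ, Finset.sum_range_succ']
      ring
    have hinv : ∀ z ≠ w, AnalyticAt ℂ (fun z => α 0 * (z - w)⁻¹) z := fun z hz =>
      analyticAt_const.mul ((analyticAt_id.sub analyticAt_const).inv (sub_ne_zero.2 hz))
    rw [boundaryIntegral_congr hab hc hdecomp,
      boundaryIntegral_add hS hab hc
        (fun z hz => (hgan z hz.1.1 hz.1.2 (hEnD z hz)).continuousAt)
        (fun z hz => ((hinv z (hEne z hz)).fun_add (hQan z (hEne z hz))).continuousAt),
      boundaryIntegral_add hS hab hc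
        (fun z hz => (hinv z (hEne z hz)).continuousAt)
        (fun z hz => (hQan z (hEne z hz)).continuousAt),
      boundaryIntegral_const_mul, boundaryIntegral_inv_sub hS ha hb hSw hwc, hQ0, hIH,
      Finset.sum_insert hwD, hL.residue_eq, Finset.sum_congr rfl hres]
    ring

/-! ### Mellin transforms of test functions -/

section

variable {φ φ' : ℝ → ℂ} {a : ℝ}

theorem mellinConvergent_of_vanishing (hφ : Continuous φ) (hv : ∀ x, a < x → φ x = 0) {z : ℂ}
    (hz : 0 < z.re) : MellinConvergent φ z :=
  mellinConvergent_of_isBigO_rpow (a := z.re + 1) (b := 0)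
    (hφ.locallyIntegrable.locallyIntegrableOn _)
    (EventuallyEq.trans_isBigO ((eventually_gt_atTop a).mono hv) (Asymptotics.isBigO_zero _ _))
    (lt_add_one _)
    (by simpa using (hφ.continuousAt.tendsto.mono_left nhdsWithin_le_nhds).isBigO_one ℝ) hz

theorem differentiableAt_mellin_of_vanishing (hφ : Continuous φ) (hv : ∀ x, a < x → φ x = 0)
    {z : ℂ} (hz : 0 < z.re) : DifferentiableAt ℂ (mellin φ) z :=
  mellin_differentiableAt_of_isBigO_rpow (a := z.re + 1) (b := 0)
    (hφ.locallyIntegrable.locallyIntegrableOn _)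
    (EventuallyEq.trans_isBigO ((eventually_gt_atTop a).mono hv) (Asymptotics.isBigO_zero _ _))
    (lt_add_one _)
    (by simpa using (hφ.continuousAt.tendsto.mono_left nhdsWithin_le_nhds).isBigO_one ℝ) hz

theorem mellin_deriv_add_one (hd : ∀ x, HasDerivAt φ (φ' x) x) (hφ' : Continuous φ')
    (hv : ∀ x, a < x → φ x = 0) {z : ℂ} (hz : 0 < z.re) :
    mellin φ' (z + 1) = -z * mellin φ z := by
  have hφ : Continuous φ := continuous_iff_continuousAt.2 fun x => (hd x).continuousAt
  have hv' : ∀ x, a < x → φ' x = 0 := fun x hx => by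
    have : φ =ᶠ[𝓝 x] fun _ => 0 := by
      filter_upwards [Ioi_mem_nhds hx] with y hy using hv y hy
    exact (hd x).unique ((hasDerivAt_const x (0 : ℂ)).congr_of_eventuallyEq this)
  have hz0 : z ≠ 0 := fun h => by simp [h] at hz
  have c1 := mellinConvergent_of_vanishing hφ hv hz
  have c2 := mellinConvergent_of_vanishing (z := z + 1) hφ' hv' (by simp; linarith)
  have hcpow : Continuous fun x : ℝ => (x : ℂ) ^ z := by
    refine continuous_iff_continuousAt.2 fun x => ?_
    exact continuousAt_ofReal_cpow_const x z (Or.inl hz)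
  have key := integral_Ioi_mul_deriv_eq_deriv_mul (a := 0) (u := fun x : ℝ => (x : ℂ) ^ z)
    (u' := fun x : ℝ => z * (x : ℂ) ^ (z - 1)) (v := φ) (v' := φ') (a' := 0) (b' := 0)
    (fun x hx => hasDerivAt_ofReal_cpow_const (ne_of_gt hx) hz0)
    (fun x _ => hd x)
    (by simpa [MellinConvergent, Pi.mul_def] using c2)
    (by
      have := c1.const_mul z
      simpa only [IntegrableOn, Pi.mul_def, smul_eq_mul, mul_assoc] using this)
    (by
      have : Continuous ((fun x : ℝ => (x : ℂ) ^ z) * φ) := hcpow.mul hφ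
      have h0 := this.tendsto 0
      simp only [Pi.mul_apply, ofReal_zero, zero_cpow hz0, zero_mul] at h0
      exact h0.mono_left nhdsWithin_le_nhds)
    (tendsto_const_nhds.congr' ((eventually_gt_atTop a).mono fun x hx => by simp [hv x hx]))
  simp only [mellin, smul_eq_mul, add_sub_cancel_right, key, mul_assoc]
  rw [integral_const_mul]
  ring

theorem norm_mellin_le {B : ℝ} (ha : 0 < a) (hv : ∀ x, a < x → φ x = 0)
    (hB : ∀ x, ‖φ x‖ ≤ B) {z : ℂ} (hz : 0 < z.re) :
    ‖mellin φ z‖ ≤ B * (a ^ z.re / z.re) := by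
  have h1 : mellin φ z = ∫ t in Ioc 0 a, (t : ℂ) ^ (z - 1) * φ t := by
    rw [mellin]
    simp only [smul_eq_mul]
    refine (setIntegral_eq_of_subset_of_forall_sdiff_eq_zero measurableSet_Ioi
      Ioc_subset_Ioi_self fun x hx => ?_)
    have : a < x := by
      by_contra h
      exact hx.2 ⟨hx.1, not_lt.1 h⟩
    rw [hv x this, mul_zero]
  rw [h1, ← intervalIntegral.integral_of_le ha.le]
  have h2 : ∫ t in 0..a, B * t ^ (z.re - 1) = B * (a ^ z.re / z.re) := by
    rw [intervalIntegral.integral_const_mul, integral_rpow (Or.inl (by linarith))]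
    simp [Real.zero_rpow hz.ne']
  rw [← h2]
  refine intervalIntegral.norm_integral_le_of_norm_le ha.le (ae_of_all _ fun t ht => ?_)
    ((intervalIntegral.intervalIntegrable_rpow' (by linarith)).const_mul B)
  rw [norm_mul, norm_cpow_eq_rpow_re_of_pos ht.1, mul_comm]
  simp only [sub_re, one_re]
  exact mul_le_mul_of_nonneg_right (hB t) (Real.rpow_nonneg ht.1.le _)

end

theorem one_add_abs_im_le {δ : ℝ} (hδ : 0 < δ) {z : ℂ} (hz : δ ≤ ‖z‖) :
    1 + |z.im| ≤ (1 + δ⁻¹) * ‖z‖ := by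
  have h1 := abs_im_le_norm z
  have h2 : 1 ≤ δ⁻¹ * ‖z‖ := by
    rw [inv_mul_eq_div, one_le_div hδ]; exact hz
  linarith

/-- Rapid decay of the Mellin transform on vertical lines, locally uniformly in the real part, by
repeated integration by parts. The factor `a ^ z.re` records where the support of `φ` ends. -/
theorem exists_norm_mellin_le {a : ℝ} (ha : 0 < a) {δ : ℝ} (hδ : 0 < δ) (k : ℕ) :
    ∀ φ : ℝ → ℂ, ContDiff ℝ (⊤ : ℕ∞) φ → HasCompactSupport φ → (∀ x, a < x → φ x = 0) →
      ∃ C : ℝ, 0 ≤ C ∧ ∀ z : ℂ, δ ≤ z.re → ‖mellin φ z‖ ≤ C * a ^ z.re * ((1 + |z.im|) ^ k)⁻¹ := by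
  induction k with
  | zero =>
    intro φ hφ hc hv
    obtain ⟨B, hB⟩ := hc.exists_bound_of_continuous hφ.continuous
    have hB0 : 0 ≤ B := (norm_nonneg _).trans (hB 0)
    refine ⟨B / δ, by positivity, fun z hz => ?_⟩
    refine (norm_mellin_le ha hv hB (hδ.trans_le hz)).trans ?_
    rw [pow_zero, inv_one, mul_one, div_mul_eq_mul_div, ← mul_div_assoc]
    exact div_le_div_of_nonneg_left (by positivity) hδ hz
  | succ k ih =>
    intro φ hφ hc hv
    have hv' : ∀ x, a < x → deriv φ x = 0 := fun x hx => by
      have : φ =ᶠ[𝓝 x] fun _ => 0 := by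
        filter_upwards [Ioi_mem_nhds hx] with y hy using hv y hy
      rw [this.deriv_eq, deriv_const]
    have hdφ : ContDiff ℝ (⊤ : ℕ∞) (deriv φ) := (contDiff_infty_iff_deriv.1 hφ).2
    obtain ⟨C, hC0, hC⟩ := ih (deriv φ) hdφ hc.deriv hv'
    refine ⟨C * a * (1 + δ⁻¹), by positivity, fun z hz => ?_⟩
    have hz0 : 0 < z.re := hδ.trans_le hz
    have hne : z ≠ 0 := fun h => by simp [h] at hz0
    have hnz : 0 < ‖z‖ := norm_pos_iff.2 hne
    have h1 := mellin_deriv_add_one (φ := φ) (φ' := deriv φ) (a := a)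
      (fun x => ((hφ.differentiable (by simp)) x).hasDerivAt) hdφ.continuous hv hz0
    have h2 := hC (z + 1) (by simp; linarith)
    rw [h1, norm_mul, norm_neg] at h2
    simp only [add_re, one_re, add_im, one_im, add_zero] at h2
    rw [Real.rpow_add ha, Real.rpow_one] at h2
    have h3 := one_add_abs_im_le hδ (hz.trans (re_le_norm z))
    have hp : 0 < 1 + |z.im| := by positivity
    have h4 : ‖z‖⁻¹ ≤ (1 + δ⁻¹) * (1 + |z.im|)⁻¹ := by
      rw [← div_eq_mul_inv, inv_le_comm₀ hnz (by positivity), inv_div, div_le_iff₀ (by positivity)]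
      linarith
    calc ‖mellin φ z‖ = ‖z‖⁻¹ * (‖z‖ * ‖mellin φ z‖) := by field_simp
      _ ≤ ((1 + δ⁻¹) * (1 + |z.im|)⁻¹) * (C * (a ^ z.re * a) * ((1 + |z.im|) ^ k)⁻¹) := by
        gcongr
      _ = C * a * (1 + δ⁻¹) * a ^ z.re * ((1 + |z.im|) ^ (k + 1))⁻¹ := by
        rw [pow_succ, mul_inv]; ring

/-- The factor `∫ ε ^ (1 - s) φ(ε) dε / (1 - s)`, the integral being over `(0, ∞)`, that the tube
formula tested against `φ` contains besides `p⁻¹ ζ(s)`. For a test function that vanishes near `∞`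
it is holomorphic in `Re s < 1`; the values at other `s` play no role. -/
noncomputable def testTransform (φ : ℝ → ℂ) (s : ℂ) : ℂ := mellin φ (2 - s) / (1 - s)

section

variable {φ : ℝ → ℂ} {a : ℝ}

theorem analyticAt_testTransform (hφ : Continuous φ) (hv : ∀ x, a < x → φ x = 0) {s : ℂ}
    (hs : s.re < 1) : AnalyticAt ℂ (testTransform φ) s := by
  rw [Complex.analyticAt_iff_eventually_differentiableAt]
  filter_upwards [(isOpen_lt continuous_re continuous_const).mem_nhds hs] with z hz
  have hz' : z.re < 1 := hz
  have h1 : DifferentiableAt ℂ (mellin φ) (2 - z) :=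
    differentiableAt_mellin_of_vanishing hφ hv (by simp; linarith)
  refine DifferentiableAt.div ?_ (by fun_prop) fun h => ?_
  · exact h1.comp z (f := fun z => 2 - z) (by fun_prop)
  · have := congrArg re h
    simp at this; linarith

theorem exists_norm_testTransform_le (ha : 0 < a) (hφ : ContDiff ℝ (⊤ : ℕ∞) φ)
    (hc : HasCompactSupport φ) (hv : ∀ x, a < x → φ x = 0) {c : ℝ} (hc1 : c < 1) (k : ℕ) :
    ∃ C : ℝ, 0 ≤ C ∧ ∀ s : ℂ, s.re ≤ c →
      ‖testTransform φ s‖ ≤ C * a ^ (-s.re) * ((1 + |s.im|) ^ k)⁻¹ := by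
  obtain ⟨C, hC0, hC⟩ := exists_norm_mellin_le ha one_pos k φ hφ hc hv
  have h1c : 0 < 1 - c := by linarith
  refine ⟨C * a ^ (2 : ℝ) / (1 - c), by positivity, fun s hs => ?_⟩
  have h1 := hC (2 - s) (by simp; linarith)
  have h2 : 1 - c ≤ ‖1 - s‖ := by
    refine le_trans ?_ (re_le_norm _)
    simp; linarith
  simp only [sub_re, sub_im, re_ofNat, im_ofNat, zero_sub, abs_neg] at h1
  rw [testTransform, norm_div]
  rw [sub_eq_add_neg (2 : ℝ), Real.rpow_add ha] at h1
  calc _ ≤ C * (a ^ (2 : ℝ) * a ^ (-s.re)) * ((1 + |s.im|) ^ k)⁻¹ / (1 - c) := by gcongr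
    _ = _ := by ring

theorem integrable_inv_one_add_abs_sq : Integrable fun t : ℝ => ((1 + |t|) ^ 2)⁻¹ := by
  have := integrable_one_add_norm (E := ℝ) (μ := volume) (r := 2) (by simp)
  refine this.congr (ae_of_all _ fun t => ?_)
  simp only [Real.norm_eq_abs]
  rw [Real.rpow_neg (by positivity)]
  norm_num

theorem integrable_testTransform_vertical (ha : 0 < a) (hφ : ContDiff ℝ (⊤ : ℕ∞) φ)
    (hc : HasCompactSupport φ) (hv : ∀ x, a < x → φ x = 0) {c : ℝ} (hc1 : c < 1) :
    Integrable fun t : ℝ => testTransform φ (c + t * I) := by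
  obtain ⟨C, hC0, hC⟩ := exists_norm_testTransform_le ha hφ hc hv hc1 2
  have hcont : Continuous fun t : ℝ => testTransform φ (c + t * I) :=
    continuous_iff_continuousAt.2 fun t => ContinuousAt.comp (f := fun t : ℝ => (c : ℂ) + t * I)
      (analyticAt_testTransform hφ.continuous hv (by simpa using hc1)).continuousAt (by fun_prop)
  refine (integrable_inv_one_add_abs_sq.const_mul (C * a ^ (-c))).mono'
    hcont.aestronglyMeasurable (ae_of_all _ fun t => ?_)
  simpa using hC (c + t * I) (by simp)

/-- Mellin inversion for the tail integral `x ↦ ∫_x^∞ φ`, whose Mellin transform at `1 - s` is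
`testTransform φ s`. -/
theorem integral_cpow_mul_testTransform (ha : 0 < a) (hφ : ContDiff ℝ (⊤ : ℕ∞) φ)
    (hc : HasCompactSupport φ) (hv : ∀ x, a < x → φ x = 0) {c : ℝ} (hc1 : c < 1)
    {x : ℝ} (hx : 0 < x) :
    (1 / (2 * Real.pi) : ℂ) * ∫ t : ℝ, (x : ℂ) ^ ((c : ℂ) + t * I) * testTransform φ (c + t * I) =
      x * ∫ ε in Ioi x, φ ε := by
  set Φ : ℝ → ℂ := fun y => ∫ ε in y..a, φ ε with hΦ
  have hd : ∀ y, HasDerivAt Φ (-φ y) y := fun y =>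
    intervalIntegral.integral_hasDerivAt_left (hφ.continuous.intervalIntegrable _ _)
      (hφ.continuous.stronglyMeasurableAtFilter _ _) hφ.continuous.continuousAt
  have hΦc : Continuous Φ := continuous_iff_continuousAt.2 fun y => (hd y).continuousAt
  have hΦv : ∀ y, a < y → Φ y = 0 := fun y hy => by
    simp only [hΦ]
    rw [intervalIntegral.integral_symm, intervalIntegral.integral_of_le hy.le,
      setIntegral_eq_zero_of_forall_eq_zero fun t ht => hv t ht.1, neg_zero]
  have hmel : ∀ s : ℂ, s.re < 1 → mellin Φ (1 - s) = testTransform φ s := by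
    intro s hs
    have hz : 0 < (1 - s).re := by simp; linarith
    have hz0 : 1 - s ≠ 0 := fun h => by simp [h] at hz
    have h1 := mellin_deriv_add_one (φ := Φ) (φ' := fun y => -φ y) (a := a) hd
      hφ.continuous.neg hΦv hz
    have h2 : mellin (fun y => -φ y) (1 - s + 1) = -mellin φ (2 - s) := by
      rw [show (1 : ℂ) - s + 1 = 2 - s by ring]
      simp only [mellin, smul_neg, integral_neg]
    rw [testTransform, eq_div_iff hz0]
    rw [h2] at h1
    linear_combination h1
  have hvert : ∀ t : ℝ, mellin Φ (((1 - c : ℝ) : ℂ) + t * I) =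
      testTransform φ (c + ((-t : ℝ) : ℂ) * I) := fun t => by
    rw [← hmel _ (by simpa using hc1)]
    congr 1
    push_cast; ring
  have hint := integrable_testTransform_vertical ha hφ hc hv hc1
  have hinv := mellinInv_mellin_eq (1 - c) Φ hx
    (mellinConvergent_of_vanishing hΦc hΦv (by simp; linarith))
    (by
      simp only [VerticalIntegrable, hvert]
      exact hint.comp_neg) hΦc.continuousAt
  have hΦx : Φ x = ∫ ε in Ioi x, φ ε := by
    rcases le_total x a with h | h
    · simp only [hΦ]
      rw [intervalIntegral.integral_of_le h]
      refine (setIntegral_eq_of_subset_of_forall_sdiff_eq_zero measurableSet_Ioi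
        Ioc_subset_Ioi_self fun t ht => hv t ?_).symm
      by_contra h'
      exact ht.2 ⟨ht.1, not_lt.1 h'⟩
    · rw [setIntegral_eq_zero_of_forall_eq_zero (t := Ioi x) fun t ht => hv t (h.trans_lt ht)]
      simp only [hΦ]
      rw [intervalIntegral.integral_symm, intervalIntegral.integral_of_le h,
        setIntegral_eq_zero_of_forall_eq_zero fun t ht => hv t ht.1, neg_zero]
  have hx0 : (x : ℂ) ≠ 0 := ofReal_ne_zero.2 hx.ne'
  have hpow : ∀ t : ℝ, (x : ℂ) ^ ((c : ℂ) + ((-t : ℝ) : ℂ) * I) =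
      x * (x : ℂ) ^ (-(((1 - c : ℝ) : ℂ) + t * I)) := fun t => by
    nth_rewrite 2 [← cpow_one (x : ℂ)]
    rw [← cpow_add _ _ hx0]
    congr 1
    push_cast
    ring
  rw [← hΦx, ← hinv, mellinInv, ← integral_neg_eq_self]
  simp only [hvert, hpow, smul_eq_mul, mul_assoc]
  rw [integral_const_mul, real_smul]
  push_cast
  ring

end

theorem pairing_tubularZeta (p : ℕ) (φ : ℝ → ℂ) (F : ℂ → ℂ) (s : ℂ) :
    pairing (fun ε => tubularZeta p F ε s) φ = (p : ℂ)⁻¹ * F s * testTransform φ s := by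
  simp only [pairing, tubularZeta, testTransform, mellin, smul_eq_mul]
  rw [mul_div_assoc', ← integral_const_mul, ← integral_div]
  refine integral_congr_ae (ae_of_all _ fun t => ?_)
  simp only
  rw [show (2 : ℂ) - s - 1 = 1 - s by ring]
  ring

theorem testTransform_dilate (φ : ℝ → ℂ) {a : ℝ} (ha : 0 < a) (s : ℂ) :
    testTransform (dilate φ a) s = (a : ℂ) ^ (1 - s) * testTransform φ s := by
  have ha0 : (a : ℂ) ≠ 0 := ofReal_ne_zero.2 ha.ne'
  have h1 := mellin_comp_mul_left φ (2 - s) (inv_pos.2 ha)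
  have h2 : mellin (dilate φ a) (2 - s) = (a : ℂ)⁻¹ * mellin (fun t => φ (a⁻¹ * t)) (2 - s) := by
    rw [← smul_eq_mul, ← mellin_const_smul]
    congr 1
    funext t
    simp only [dilate, smul_eq_mul, div_eq_inv_mul]
  rw [testTransform, testTransform, h2, h1, ofReal_inv, inv_cpow _ _ (by
    rw [arg_ofReal_of_nonneg ha.le]; exact Real.pi_pos.ne), cpow_neg, inv_inv, smul_eq_mul,
    show (1 : ℂ) - s = -1 + (2 - s) by ring, cpow_add _ _ ha0, cpow_neg_one]
  ring

/-! ### The measure of `p`-adic balls -/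

section

variable {p : ℕ} [Fact p.Prime]

instance isAddHaarMeasure_haar : (haar p).IsAddHaarMeasure := by
  unfold haar; infer_instance

theorem prime_cast_pos : (0 : ℝ) < p := Nat.cast_pos.2 (Fact.out (p := p.Prime)).pos

theorem one_lt_prime_cast : (1 : ℝ) < p := Nat.one_lt_cast.2 (Fact.out (p := p.Prime)).one_lt

/-- A ball is covered by the `p` balls of the next smaller radius around the base-`p` digits. -/
theorem padic_closedBall_eq_iUnion (n : ℤ) :
    Metric.closedBall (0 : ℚ_[p]) ((p : ℝ) ^ (-n)) =
      ⋃ i : Fin p, Metric.closedBall ((i : ℕ) * (p : ℚ_[p]) ^ n) ((p : ℝ) ^ (-(n + 1))) := by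
  have hp0 : (p : ℚ_[p]) ≠ 0 := Nat.cast_ne_zero.2 (Fact.out (p := p.Prime)).ne_zero
  have hpp := prime_cast_pos (p := p)
  apply Subset.antisymm
  · intro x hx
    rw [mem_closedBall_zero_iff] at hx
    have hy : ‖x * (p : ℚ_[p]) ^ (-n)‖ ≤ 1 := by
      rw [norm_mul, Padic.norm_p_zpow, neg_neg]
      calc ‖x‖ * (p : ℝ) ^ n ≤ (p : ℝ) ^ (-n) * (p : ℝ) ^ n := by gcongr
        _ = 1 := by rw [← zpow_add₀ hpp.ne']; simp
    obtain ⟨y, hyx⟩ : ∃ y : ℤ_[p], (y : ℚ_[p]) = x * (p : ℚ_[p]) ^ (-n) := ⟨⟨_, hy⟩, rfl⟩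
    obtain ⟨i, hi, hmem⟩ := PadicInt.exists_mem_range y
    rw [PadicInt.maximalIdeal_eq_span_p, Ideal.mem_span_singleton, ← PadicInt.norm_lt_one_iff_dvd,
      PadicInt.norm_def] at hmem
    rw [PadicInt.coe_sub, PadicInt.coe_natCast, hyx] at hmem
    refine mem_iUnion.2 ⟨⟨i, hi⟩, ?_⟩
    rw [mem_closedBall_iff_norm]
    have hle := (Padic.norm_le_pow_iff_norm_lt_pow_add_one
      (x * (p : ℚ_[p]) ^ (-n) - (i : ℚ_[p])) (-1)).2 (by
        rw [neg_add_cancel, zpow_zero]; exact hmem)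
    have e : x - i * (p : ℚ_[p]) ^ n = (x * (p : ℚ_[p]) ^ (-n) - i) * (p : ℚ_[p]) ^ n := by
      rw [sub_mul, mul_assoc, ← zpow_add₀ hp0]; simp
    rw [e, norm_mul, Padic.norm_p_zpow]
    calc _ ≤ (p : ℝ) ^ (-1 : ℤ) * (p : ℝ) ^ (-n) := by gcongr
      _ = _ := by rw [← zpow_add₀ hpp.ne']; congr 1; ring
  · refine iUnion_subset fun i => ?_
    have h1 : ((i : ℕ) : ℚ_[p]) * (p : ℚ_[p]) ^ n ∈
        Metric.closedBall (0 : ℚ_[p]) ((p : ℝ) ^ (-n)) := by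
      rw [mem_closedBall_zero_iff, norm_mul, Padic.norm_p_zpow]
      have := Padic.norm_int_le_one (p := p) (i : ℕ)
      push_cast at this
      exact mul_le_of_le_one_left (by positivity) this
    rw [IsUltrametricDist.closedBall_eq_of_mem h1]
    exact Metric.closedBall_subset_closedBall
      (zpow_le_zpow_right₀ (one_lt_prime_cast (p := p)).le (by omega))

theorem haar_closedBall_succ (n : ℤ) :
    haar p (Metric.closedBall (0 : ℚ_[p]) ((p : ℝ) ^ (-n))) =
      p * haar p (Metric.closedBall (0 : ℚ_[p]) ((p : ℝ) ^ (-(n + 1)))) := by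
  have hpp := prime_cast_pos (p := p)
  rw [padic_closedBall_eq_iUnion, measure_iUnion]
  · simp only [Measure.addHaar_closedBall_center]
    rw [tsum_fintype, Finset.sum_const, Finset.card_univ, Fintype.card_fin, nsmul_eq_mul]
  · intro i j hij
    rcases IsUltrametricDist.closedBall_eq_or_disjoint ((i : ℕ) * (p : ℚ_[p]) ^ n)
      ((j : ℕ) * (p : ℚ_[p]) ^ n) ((p : ℝ) ^ (-(n + 1))) with h | h
    · exfalso
      have hm : ((i : ℕ) : ℚ_[p]) * (p : ℚ_[p]) ^ n ∈
          Metric.closedBall ((j : ℕ) * (p : ℚ_[p]) ^ n) ((p : ℝ) ^ (-(n + 1))) :=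
        h ▸ Metric.mem_closedBall_self (by positivity)
      rw [mem_closedBall_iff_norm, ← sub_mul, norm_mul, Padic.norm_p_zpow] at hm
      have h2 : ‖((((i : ℕ) : ℤ) - ((j : ℕ) : ℤ) : ℤ) : ℚ_[p])‖ < 1 := by
        push_cast
        have : (p : ℝ) ^ (-(n + 1)) = (p : ℝ)⁻¹ * (p : ℝ) ^ (-n) := by
          rw [← zpow_neg_one, ← zpow_add₀ hpp.ne']; congr 1; ring
        rw [this] at hm
        exact (le_of_mul_le_mul_right hm (by positivity)).trans_lt
          (inv_lt_one_of_one_lt₀ (one_lt_prime_cast (p := p)))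
      rw [Padic.norm_intCast_lt_one_iff] at h2
      have hi := i.2
      have hj := j.2
      have h3 : ((i : ℕ) : ℤ) - ((j : ℕ) : ℤ) = 0 :=
        Int.eq_zero_of_abs_lt_dvd h2 (by rw [abs_lt]; constructor <;> omega)
      exact hij (Fin.ext (by omega))
    · exact h
  · exact fun i => Metric.isClosed_closedBall.measurableSet

/-- Each ball splits into `p` balls of the next smaller radius, which gives the measures of all
balls from that of the unit ball. -/
theorem haar_real_closedBall (x : ℚ_[p]) (n : ℤ) :
    (haar p).real (Metric.closedBall x ((p : ℝ) ^ (-n))) = (p : ℝ) ^ (-n) := by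
  have hpp := prime_cast_pos (p := p)
  have hs : ∀ n : ℤ, (haar p).real (Metric.closedBall (0 : ℚ_[p]) ((p : ℝ) ^ (-n))) =
      p * (haar p).real (Metric.closedBall (0 : ℚ_[p]) ((p : ℝ) ^ (-(n + 1)))) := fun n => by
    rw [measureReal_def, haar_closedBall_succ, ENNReal.toReal_mul, measureReal_def]
    simp
  have h0 : (haar p).real (Metric.closedBall (0 : ℚ_[p]) ((p : ℝ) ^ (-(0 : ℤ)))) = 1 := by
    rw [measureReal_def, neg_zero, zpow_zero]
    have := Measure.addHaarMeasure_self (K₀ := (⟨⟨Metric.closedBall (0 : ℚ_[p]) 1,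
      isCompact_closedBall 0 1⟩, unitBall_interior_nonempty p⟩ :
        TopologicalSpace.PositiveCompacts ℚ_[p]))
    rw [haar]
    exact (congrArg ENNReal.toReal this).trans ENNReal.toReal_one
  have key : ∀ n : ℤ, (haar p).real (Metric.closedBall (0 : ℚ_[p]) ((p : ℝ) ^ (-n))) =
      (p : ℝ) ^ (-n) := by
    intro n
    induction n with
    | zero => rw [h0]; simp
    | succ n ih =>
      rw [hs] at ih
      apply mul_left_cancel₀ hpp.ne'
      rw [ih, ← zpow_one_add₀ hpp.ne']
      congr 1; ring
    | pred n ih =>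
      rw [hs, sub_add_cancel, ih, ← zpow_one_add₀ hpp.ne']
      congr 1; ring
  rw [measureReal_def, Measure.addHaar_closedBall_center, ← measureReal_def, key]

theorem padic_ball_eq_closedBall (x : ℚ_[p]) (n : ℤ) :
    Metric.ball x ((p : ℝ) ^ (-n)) = Metric.closedBall x ((p : ℝ) ^ (-(n + 1))) := by
  ext y
  rw [mem_ball_iff_norm, mem_closedBall_iff_norm, Padic.norm_le_pow_iff_norm_lt_pow_add_one]
  congr! 2
  ring

theorem exists_mem_sphere (x : ℚ_[p]) (n : ℤ) : ∃ y, y ∈ Metric.sphere x ((p : ℝ) ^ (-n)) :=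
  ⟨x + (p : ℚ_[p]) ^ n, by rw [mem_sphere_iff_norm, add_sub_cancel_left, Padic.norm_p_zpow]⟩

/-! ### The components of a bounded open set -/

theorem SameComponent.symm {Ω : Set ℚ_[p]} {x y : ℚ_[p]} (h : SameComponent Ω x y) :
    SameComponent Ω y x := by
  obtain ⟨a, r, hr, hs, hx, hy⟩ := h
  exact ⟨a, r, hr, hs, hy, hx⟩

theorem SameComponent.trans {Ω : Set ℚ_[p]} {x y z : ℚ_[p]} (h : SameComponent Ω x y)
    (h' : SameComponent Ω y z) : SameComponent Ω x z := by
  obtain ⟨a, r, hr, hs, hx, hy⟩ := h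
  obtain ⟨a', r', hr', hs', hy', hz'⟩ := h'
  rw [IsUltrametricDist.closedBall_eq_of_mem hy] at hs hx
  rw [IsUltrametricDist.closedBall_eq_of_mem hy'] at hs' hz'
  rcases le_total r r' with h | h
  · exact ⟨y, r', hr', hs', Metric.closedBall_subset_closedBall h hx, hz'⟩
  · exact ⟨y, r, hr, hs, hx, Metric.closedBall_subset_closedBall h hz'⟩

theorem sameComponent_self {Ω : Set ℚ_[p]} (hΩ : IsOpen Ω) {x : ℚ_[p]} (hx : x ∈ Ω) :
    SameComponent Ω x x := by
  obtain ⟨r, hr, hs⟩ := Metric.nhds_basis_closedBall.mem_iff.1 (hΩ.mem_nhds hx)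
  exact ⟨x, r, hr, hs, Metric.mem_closedBall_self hr.le, Metric.mem_closedBall_self hr.le⟩

theorem subset_of_mem_components {Ω B : Set ℚ_[p]} (hB : B ∈ components Ω) : B ⊆ Ω := by
  obtain ⟨x, hx, rfl⟩ := hB
  rintro y ⟨a, r, hr, hs, -, hy⟩
  exact hs hy

theorem eq_of_mem_components {Ω B B' : Set ℚ_[p]} (hB : B ∈ components Ω)
    (hB' : B' ∈ components Ω) {y : ℚ_[p]} (hy : y ∈ B) (hy' : y ∈ B') : B = B' := by
  obtain ⟨x, hx, rfl⟩ := hB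
  obtain ⟨x', hx', rfl⟩ := hB'
  change SameComponent Ω x y at hy
  change SameComponent Ω x' y at hy'
  ext z
  exact ⟨fun h => SameComponent.trans hy' (SameComponent.trans (SameComponent.symm hy) h),
    fun h => SameComponent.trans hy (SameComponent.trans (SameComponent.symm hy') h)⟩

theorem exists_mem_components {Ω : Set ℚ_[p]} (hΩ : IsOpen Ω) {x : ℚ_[p]} (hx : x ∈ Ω) :
    ∃ B ∈ components Ω, x ∈ B :=
  ⟨_, ⟨x, hx, rfl⟩, sameComponent_self hΩ hx⟩

/-- The components of a bounded open set are balls of radius `p ^ (-n)`, centred at any of their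
points; boundedness provides a largest such ball. -/
theorem exists_closedBall_of_mem_components {Ω B : Set ℚ_[p]} (hΩ : IsOpen Ω)
    (hbdd : Bornology.IsBounded Ω) (hB : B ∈ components Ω) :
    ∃ n : ℤ, ∀ a ∈ B, B = Metric.closedBall a ((p : ℝ) ^ (-n)) := by
  have hp1 := one_lt_prime_cast (p := p)
  have hpp := prime_cast_pos (p := p)
  obtain ⟨x, hx, rfl⟩ := hB
  obtain ⟨r, hr, hs⟩ := Metric.nhds_basis_closedBall.mem_iff.1 (hΩ.mem_nhds hx)
  obtain ⟨R, hR⟩ := hbdd.subset_closedBall x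
  have hex : ∃ n : ℤ, Metric.closedBall x ((p : ℝ) ^ (-n)) ⊆ Ω := by
    obtain ⟨k, hk⟩ := exists_pow_lt_of_lt_one hr (inv_lt_one_of_one_lt₀ hp1)
    refine ⟨k, (Metric.closedBall_subset_closedBall ?_).trans hs⟩
    rw [zpow_neg, zpow_natCast, ← inv_pow]
    exact hk.le
  have hbd : ∃ b : ℤ, ∀ n : ℤ, Metric.closedBall x ((p : ℝ) ^ (-n)) ⊆ Ω → b ≤ n := by
    obtain ⟨k, hk⟩ := pow_unbounded_of_one_lt R hp1
    refine ⟨-k, fun n hn => ?_⟩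
    by_contra hlt
    obtain ⟨y, hy⟩ := exists_mem_sphere x n
    have h1 := hR (hn (Metric.sphere_subset_closedBall hy))
    rw [mem_sphere_iff_norm] at hy
    rw [mem_closedBall_iff_norm, hy] at h1
    have h2 : (p : ℝ) ^ (k : ℤ) ≤ (p : ℝ) ^ (-n) := zpow_le_zpow_right₀ hp1.le (by omega)
    rw [zpow_natCast] at h2
    linarith
  obtain ⟨n, hn, hmin⟩ := Int.exists_least_of_bdd hbd hex
  have hBx : {y | SameComponent Ω x y} = Metric.closedBall x ((p : ℝ) ^ (-n)) := by
    ext y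
    constructor
    · rintro ⟨a, r, hr, hs, hxa, hya⟩
      rw [IsUltrametricDist.closedBall_eq_of_mem hxa] at hs hya
      rcases eq_or_ne y x with rfl | hne
      · exact Metric.mem_closedBall_self (by positivity)
      obtain ⟨k, hk⟩ : ∃ k : ℤ, ‖y - x‖ = (p : ℝ) ^ (-k) :=
        ⟨_, Padic.norm_eq_zpow_neg_valuation (sub_ne_zero.2 hne)⟩
      rw [mem_closedBall_iff_norm] at hya ⊢
      rw [hk] at hya ⊢
      have := hmin k ((Metric.closedBall_subset_closedBall hya).trans hs)
      exact zpow_le_zpow_right₀ hp1.le (by omega)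
    · intro hy
      exact ⟨x, _, by positivity, hn, Metric.mem_closedBall_self (by positivity), hy⟩
  refine ⟨n, fun a ha => ?_⟩
  rw [hBx] at ha ⊢
  exact (IsUltrametricDist.closedBall_eq_of_mem ha)

theorem exists_len_eq {Ω B : Set ℚ_[p]} (hΩ : IsOpen Ω) (hbdd : Bornology.IsBounded Ω)
    (hB : B ∈ components Ω) :
    ∃ n : ℤ, len B = (p : ℝ) ^ (-n) ∧ ∀ a ∈ B, B = Metric.closedBall a ((p : ℝ) ^ (-n)) := by
  obtain ⟨n, hn⟩ := exists_closedBall_of_mem_components hΩ hbdd hB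
  refine ⟨n, ?_, hn⟩
  have : B.Nonempty := by
    obtain ⟨x, hx, rfl⟩ := hB
    exact ⟨x, sameComponent_self hΩ hx⟩
  obtain ⟨a, ha⟩ := this
  rw [hn a ha, len, haar_real_closedBall]

theorem len_pos_of_mem_components {Ω B : Set ℚ_[p]} (hΩ : IsOpen Ω) (hbdd : Bornology.IsBounded Ω)
    (hB : B ∈ components Ω) : 0 < len B := by
  obtain ⟨n, hn, -⟩ := exists_len_eq hΩ hbdd hB
  have hpp := prime_cast_pos (p := p)
  rw [hn]; positivity

theorem haar_lt_top_of_isBounded {Ω : Set ℚ_[p]} (hbdd : Bornology.IsBounded Ω) :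
    haar p Ω < ⊤ := hbdd.measure_lt_top

theorem len_le_of_mem_components {Ω B : Set ℚ_[p]} (hbdd : Bornology.IsBounded Ω)
    (hB : B ∈ components Ω) : len B ≤ (haar p).real Ω :=
  measureReal_mono (subset_of_mem_components hB) (haar_lt_top_of_isBounded hbdd).ne

theorem eq_closedBall_center {Ω B : Set ℚ_[p]} (hΩ : IsOpen Ω) (hbdd : Bornology.IsBounded Ω)
    (hB : B ∈ components Ω) {a : ℚ_[p]} (ha : a ∈ B) : B = Metric.closedBall a (len B) := by
  obtain ⟨n, hn, h⟩ := exists_len_eq hΩ hbdd hB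
  rw [hn]; exact h a ha

theorem countable_components {Ω : Set ℚ_[p]} (hΩ : IsOpen Ω) (hbdd : Bornology.IsBounded Ω) :
    (components Ω).Countable := by
  refine PairwiseDisjoint.countable_of_isOpen (s := id) (fun B hB B' hB' hne => ?_)
    (fun B hB => ?_) fun B hB => ?_
  · exact Set.disjoint_left.2 fun y hy hy' => hne (eq_of_mem_components hB hB' hy hy')
  · obtain ⟨n, hn, h⟩ := exists_len_eq hΩ hbdd hB
    obtain ⟨x, hx, rfl⟩ := hB
    rw [id, h x (sameComponent_self hΩ hx)]
    have hpp := prime_cast_pos (p := p)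
    exact IsUltrametricDist.isOpen_closedBall x (by positivity)
  · obtain ⟨x, hx, rfl⟩ := hB
    exact ⟨x, sameComponent_self hΩ hx⟩

/-! ### The volume of the thin tube -/

theorem mem_metricBoundary_iff {Ω : Set ℚ_[p]} (hΩ : IsOpen Ω) (hbdd : Bornology.IsBounded Ω)
    {c : Set ℚ_[p] → ℚ_[p]} (hc : ∀ B ∈ components Ω, c B ∈ B) {x : ℚ_[p]} :
    x ∈ metricBoundary Ω c ↔ ∃ B ∈ components Ω, x ∈ Metric.sphere (c B) (len B) := by
  constructor
  · rintro ⟨B, hB, n, hn, hx⟩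
    refine ⟨B, hB, ?_⟩
    have : len B = (p : ℝ) ^ (-n) := by
      rw [hn, len, haar_real_closedBall]
    rwa [this]
  · rintro ⟨B, hB, hx⟩
    obtain ⟨n, hn, h⟩ := exists_len_eq hΩ hbdd hB
    exact ⟨B, hB, n, h _ (hc B hB), hn ▸ hx⟩

theorem dist_eq_of_mem_ball_of_mem_sphere {a x y : ℚ_[p]} {r : ℝ} (hx : x ∈ Metric.ball a r)
    (hy : y ∈ Metric.sphere a r) : dist x y = r := by
  rw [Metric.mem_ball] at hx
  rw [mem_sphere_iff_norm] at hy
  rw [dist_eq_norm] at hx ⊢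
  have h : ‖x - a‖ ≠ ‖a - y‖ := by
    rw [norm_sub_rev a y, hy]; exact hx.ne
  have e : x - y = (x - a) + (a - y) := by ring
  rw [e, Padic.add_eq_max_of_ne h, norm_sub_rev a y, hy]
  exact max_eq_right hx.le

/-- Inside a component of length `l` the distance to the metric boundary is constantly `l` off the
sphere, so the thin tube is a union of whole open balls. -/
theorem thinTube_eq_iUnion {Ω : Set ℚ_[p]} (hΩ : IsOpen Ω) (hbdd : Bornology.IsBounded Ω)
    {c : Set ℚ_[p] → ℚ_[p]} (hc : ∀ B ∈ components Ω, c B ∈ B) (ε : ℝ) :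
    thinTube Ω c ε =
      ⋃ B : components Ω, {x | len (B : Set ℚ_[p]) < ε ∧
        x ∈ Metric.ball (c B) (len (B : Set ℚ_[p]))} := by
  ext x
  simp only [mem_iUnion, mem_ofPred_eq, Subtype.exists, exists_prop]
  constructor
  · rintro ⟨⟨hxΩ, hxε⟩, hxn⟩
    obtain ⟨B, hB, hxB⟩ := exists_mem_components hΩ hxΩ
    have hball : x ∈ Metric.ball (c B) (len B) := by
      have h1 := eq_closedBall_center hΩ hbdd hB (hc B hB)
      rw [h1] at hxB
      refine lt_of_le_of_ne (Metric.mem_closedBall.1 hxB) fun h => hxn ?_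
      exact (mem_metricBoundary_iff hΩ hbdd hc).2 ⟨B, hB, h⟩
    refine ⟨B, hB, lt_of_le_of_lt ?_ hxε, hball⟩
    obtain ⟨n, hn, -⟩ := exists_len_eq hΩ hbdd hB
    obtain ⟨y₀, hy₀⟩ := exists_mem_sphere (c B) n
    refine (Metric.le_infDist ⟨y₀, (mem_metricBoundary_iff hΩ hbdd hc).2 ⟨B, hB, hn ▸ hy₀⟩⟩).2 ?_
    intro y hy
    obtain ⟨B', hB', hyB'⟩ := (mem_metricBoundary_iff hΩ hbdd hc).1 hy
    by_cases hBB : B' = B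
    · subst hBB
      exact (dist_eq_of_mem_ball_of_mem_sphere hball hyB').ge
    · by_contra hlt
      apply hBB
      have hyB : y ∈ B := by
        rw [eq_closedBall_center hΩ hbdd hB hxB, Metric.mem_closedBall, dist_comm]
        exact (not_le.1 hlt).le
      refine eq_of_mem_components hB' hB ?_ hyB
      rw [eq_closedBall_center hΩ hbdd hB' (hc B' hB')]
      exact Metric.sphere_subset_closedBall hyB'
  · rintro ⟨B, hB, hlt, hx⟩
    have hxB : x ∈ B := by
      rw [eq_closedBall_center hΩ hbdd hB (hc B hB)]
      exact Metric.ball_subset_closedBall hx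
    refine ⟨⟨subset_of_mem_components hB hxB, ?_⟩, fun h => ?_⟩
    · obtain ⟨n, hn, -⟩ := exists_len_eq hΩ hbdd hB
      obtain ⟨y, hy⟩ := exists_mem_sphere (c B) n
      rw [← hn] at hy
      refine (Metric.infDist_le_dist_of_mem
        ((mem_metricBoundary_iff hΩ hbdd hc).2 ⟨B, hB, hy⟩)).trans_lt ?_
      rwa [dist_eq_of_mem_ball_of_mem_sphere hx hy]
    · obtain ⟨B', hB', hx'⟩ := (mem_metricBoundary_iff hΩ hbdd hc).1 h
      have : B' = B := by
        refine eq_of_mem_components hB' hB ?_ hxB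
        rw [eq_closedBall_center hΩ hbdd hB' (hc B' hB')]
        exact Metric.sphere_subset_closedBall hx'
      subst this
      exact (Metric.mem_ball.1 hx).ne hx'

open Classical in
/-- A component of length `l < ε` contributes the open ball of radius `l` around its centre, of
measure `l / p`; longer components contribute nothing. -/
theorem tubeVolume_eq_tsum {Ω : Set ℚ_[p]} (hΩ : IsOpen Ω) (hbdd : Bornology.IsBounded Ω)
    {c : Set ℚ_[p] → ℚ_[p]} (hc : ∀ B ∈ components Ω, c B ∈ B) (ε : ℝ) :
    tubeVolume Ω c ε = ∑' B : components Ω,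
      if len (B : Set ℚ_[p]) < ε then (p : ℝ)⁻¹ * len (B : Set ℚ_[p]) else 0 := by
  have hcount : Countable (components Ω) := (countable_components hΩ hbdd).to_subtype
  have hpp := prime_cast_pos (p := p)
  have hball : ∀ B : components Ω,
      (haar p).real (Metric.ball (c B) (len (B : Set ℚ_[p]))) =
        (p : ℝ)⁻¹ * len (B : Set ℚ_[p]) := by
    intro B
    obtain ⟨n, hn, -⟩ := exists_len_eq hΩ hbdd B.2
    rw [hn, padic_ball_eq_closedBall, haar_real_closedBall, ← zpow_neg_one, ← zpow_add₀ hpp.ne']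
    congr 1; ring
  have hset : ∀ B : components Ω,
      {x | len (B : Set ℚ_[p]) < ε ∧ x ∈ Metric.ball (c B) (len (B : Set ℚ_[p]))} =
        if len (B : Set ℚ_[p]) < ε then Metric.ball (c B) (len (B : Set ℚ_[p])) else ∅ := by
    intro B
    ext x
    split_ifs with h <;> simp [h]
  rw [tubeVolume, measureReal_def, thinTube_eq_iUnion hΩ hbdd hc, measure_iUnion,
    ENNReal.tsum_toReal_eq]
  · refine tsum_congr fun B => ?_
    rw [hset]
    split_ifs with h
    · exact hball B
    · simp
  · intro B
    rw [hset]
    split_ifs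
    · exact measure_ball_lt_top.ne
    · simp
  · intro B B' hne
    refine Set.disjoint_left.2 fun y hy hy' => hne (Subtype.ext ?_)
    refine eq_of_mem_components B.2 B'.2 (y := y) ?_ ?_
    · rw [eq_closedBall_center hΩ hbdd B.2 (hc B B.2)]
      exact Metric.ball_subset_closedBall hy.2
    · rw [eq_closedBall_center hΩ hbdd B'.2 (hc B' B'.2)]
      exact Metric.ball_subset_closedBall hy'.2
  · intro B
    rw [hset]
    split_ifs
    · exact Metric.isOpen_ball.measurableSet
    · exact MeasurableSet.empty

theorem tubeVolume_le {Ω : Set ℚ_[p]} (hbdd : Bornology.IsBounded Ω) (c : Set ℚ_[p] → ℚ_[p])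
    (ε : ℝ) : tubeVolume Ω c ε ≤ (haar p).real Ω :=
  measureReal_mono (fun _ hx => hx.1.1) (haar_lt_top_of_isBounded hbdd).ne

theorem monotone_tubeVolume {Ω : Set ℚ_[p]} (hbdd : Bornology.IsBounded Ω)
    (c : Set ℚ_[p] → ℚ_[p]) : Monotone (tubeVolume Ω c) := fun _ _ h =>
  measureReal_mono (fun _ hx => ⟨⟨hx.1.1, hx.1.2.trans_le h⟩, hx.2⟩)
    ((measure_mono fun _ hx => hx.1.1).trans_lt (haar_lt_top_of_isBounded hbdd)).ne

theorem summable_len_rpow {Ω : Set ℚ_[p]} (hΩ : IsOpen Ω) (hbdd : Bornology.IsBounded Ω)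
    {β : ℝ} (hβ : abscissa Ω < (β : EReal)) :
    Summable fun B : components Ω => len (B : Set ℚ_[p]) ^ β := by
  obtain ⟨_, ⟨α, hα, rfl⟩, hlt⟩ := sInf_lt_iff.1 hβ
  have hαβ : α < β := EReal.coe_lt_coe_iff.1 hlt
  refine Summable.of_nonneg_of_le (fun B => Real.rpow_nonneg measureReal_nonneg _) (fun B => ?_)
    ((hα : Summable _).mul_right ((haar p).real Ω ^ (β - α)))
  have hl := len_pos_of_mem_components hΩ hbdd B.2
  calc len (B : Set ℚ_[p]) ^ β = len (B : Set ℚ_[p]) ^ α * len (B : Set ℚ_[p]) ^ (β - α) := by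
        rw [← Real.rpow_add hl]; congr 1; ring
    _ ≤ _ := by
      refine mul_le_mul_of_nonneg_left ?_ (Real.rpow_nonneg hl.le _)
      exact Real.rpow_le_rpow hl.le (len_le_of_mem_components hbdd B.2) (by linarith)

end

/-! ### The geometric zeta function and its continuation -/

section

variable {p : ℕ} [Fact p.Prime] {Ω : Set ℚ_[p]}

theorem norm_len_cpow (hΩ : IsOpen Ω) (hbdd : Bornology.IsBounded Ω) (B : components Ω) (s : ℂ) :
    ‖(len (B : Set ℚ_[p]) : ℂ) ^ s‖ = len (B : Set ℚ_[p]) ^ s.re :=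
  norm_cpow_eq_rpow_re_of_pos (len_pos_of_mem_components hΩ hbdd B.2) s

theorem norm_zetaSeries_le (hΩ : IsOpen Ω) (hbdd : Bornology.IsBounded Ω) {s : ℂ}
    (hs : abscissa Ω < (s.re : EReal)) :
    ‖zetaSeries Ω s‖ ≤ ∑' B : components Ω, len (B : Set ℚ_[p]) ^ s.re := by
  have hsum := summable_len_rpow hΩ hbdd hs
  refine (norm_tsum_le_tsum_norm ?_).trans_eq (tsum_congr fun B => norm_len_cpow hΩ hbdd B s)
  exact hsum.congr fun B => (norm_len_cpow hΩ hbdd B s).symm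

theorem analyticAt_of_not_isPole {U : Set ℂ} {f : ℂ → ℂ} (hf : IsContinuation Ω U f) {z : ℂ}
    (hz : z ∈ U) (hp : ¬ IsPole f z) : AnalyticAt ℂ f z :=
  (hf.meromorphic hz).meromorphicOrderAt_nonneg_iff_analyticAt.1 (not_lt.1 hp)

/-- In the half-plane of absolute convergence the zeta function is locally bounded, so that its
continuation has no poles there. -/
theorem not_isPole_of_abscissa_lt (hΩ : IsOpen Ω) (hbdd : Bornology.IsBounded Ω) {U : Set ℂ}
    {f : ℂ → ℂ} (hf : IsContinuation Ω U f) {w : ℂ} (hw : w ∈ U)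
    (hre : abscissa Ω < (w.re : EReal)) : ¬ IsPole f w := by
  intro hpole
  obtain ⟨c₁, h1, h2⟩ := EReal.lt_iff_exists_real_btwn.1 hre
  have h2' : c₁ < w.re := EReal.coe_lt_coe_iff.1 h2
  have h3 : abscissa Ω < ((w.re + 1 : ℝ) : EReal) :=
    hre.trans (EReal.coe_lt_coe_iff.2 (lt_add_one _))
  have s1 := summable_len_rpow hΩ hbdd h1
  have s2 := summable_len_rpow hΩ hbdd h3
  have htend := tendsto_norm_cobounded_atTop.comp
    (tendsto_cobounded_of_meromorphicOrderAt_neg hpole)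
  have hbig := htend.eventually_gt_atTop
    (∑' B : components Ω, (len (B : Set ℚ_[p]) ^ c₁ + len (B : Set ℚ_[p]) ^ (w.re + 1)))
  have hnear : ∀ᶠ z in 𝓝[≠] w, z ∈ U ∧ c₁ < z.re ∧ z.re < w.re + 1 := by
    refine nhdsWithin_le_nhds ?_
    filter_upwards [hf.isOpen.mem_nhds hw,
      (isOpen_lt continuous_const continuous_re).mem_nhds h2',
      (isOpen_lt continuous_re continuous_const).mem_nhds (lt_add_one w.re)] with z a b c
    exact ⟨a, b, c⟩
  obtain ⟨z, hz, hzU, hz1, hz2⟩ := (hbig.and hnear).exists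
  have hz1' : abscissa Ω < (z.re : EReal) := h1.trans (EReal.coe_lt_coe_iff.2 hz1)
  have hle : ‖f z‖ ≤
      ∑' B : components Ω, (len (B : Set ℚ_[p]) ^ c₁ + len (B : Set ℚ_[p]) ^ (w.re + 1)) := by
    rw [hf.eq_series z hzU hz1']
    refine (norm_zetaSeries_le hΩ hbdd hz1').trans
      ((summable_len_rpow hΩ hbdd hz1').tsum_le_tsum (fun B => ?_) (s1.add s2))
    have hl := len_pos_of_mem_components hΩ hbdd B.2
    have n1 := Real.rpow_nonneg hl.le c₁
    have n2 := Real.rpow_nonneg hl.le (w.re + 1)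
    rcases le_total (len (B : Set ℚ_[p])) 1 with h | h
    · have := Real.rpow_le_rpow_of_exponent_ge hl h hz1.le
      linarith
    · have := Real.rpow_le_rpow_of_exponent_le h hz2.le
      linarith
  exact absurd hz (not_lt.2 hle)

theorem re_lt_of_isPole (hΩ : IsOpen Ω) (hbdd : Bornology.IsBounded Ω) {U : Set ℂ}
    {f : ℂ → ℂ} (hf : IsContinuation Ω U f) {w : ℂ} (hw : w ∈ U) (hp : IsPole f w) {c : ℝ}
    (hc : abscissa Ω < (c : EReal)) : w.re < c := by
  by_contra h
  exact not_isPole_of_abscissa_lt hΩ hbdd hf hw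
    (hc.trans_le (EReal.coe_le_coe_iff.2 (not_lt.1 h))) hp

/-- Only finitely many poles lie in a bounded horizontal strip of the window. -/
theorem finite_visibleDimensions_strip (hΩ : IsOpen Ω) (hbdd : Bornology.IsBounded Ω)
    (hσ : abscissa Ω < 1) {U : Set ℂ} {f : ℂ → ℂ} (hf : IsContinuation Ω U f) {S : ℝ → ℝ}
    (hS : IsScreen S) (hW : window S ⊆ U) (a b : ℝ) :
    {w | w ∈ visibleDimensions f (window S) ∧ a < w.im ∧ w.im < b}.Finite := by
  obtain ⟨K, hK⟩ := hS.lipschitz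
  obtain ⟨M, hM⟩ := hS.bounded
  set R : Set ℂ := (Icc (-M) 1 ×ℂ Icc a b) ∩ window S with hR
  have hclosed : IsClosed (window S) :=
    isClosed_le (hK.continuous.comp continuous_im) continuous_re
  have hRc : IsCompact R := (isCompact_Icc.reProdIm isCompact_Icc).inter_right hclosed
  by_contra hinf
  obtain ⟨z, hzR, hacc⟩ := Set.Infinite.exists_accPt_of_subset_isCompact hinf hRc (by
    rintro w ⟨⟨hw1, hw2⟩, h1, h2⟩
    have := re_lt_of_isPole hΩ hbdd hf (hW hw1) hw2 (c := 1) (by exact_mod_cast hσ)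
    have hw1' : S w.im ≤ w.re := hw1
    have := hM w.im
    rw [abs_le] at this
    exact ⟨⟨⟨by linarith, by linarith⟩, h1.le, h2.le⟩, hw1⟩)
  have han : ∀ᶠ x in 𝓝[≠] z, AnalyticAt ℂ f x :=
    (hf.meromorphic (hW hzR.2)).meromorphicAt.eventually_analyticAt
  rw [accPt_iff_frequently_nhdsNE] at hacc
  obtain ⟨x, hx, hxa⟩ := (hacc.and_eventually han).exists
  exact absurd hx.1.2 (not_lt.2 hxa.meromorphicOrderAt_nonneg)

/-! ### The tube volume tested against a function -/

theorem integrableOn_tubeVolume_mul (hbdd : Bornology.IsBounded Ω)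
    (c : Set ℚ_[p] → ℚ_[p]) {φ : ℝ → ℂ} (hφ : Continuous φ) (hcs : HasCompactSupport φ) :
    IntegrableOn (fun ε => (tubeVolume Ω c ε : ℂ) * φ ε) (Ioi 0) := by
  have hint : Integrable φ := hφ.integrable_of_hasCompactSupport hcs
  refine Integrable.integrableOn (hint.bdd_mul (c := (haar p).real Ω) ?_ (ae_of_all _ fun ε => ?_))
  · exact (measurable_ofReal.comp (monotone_tubeVolume hbdd c).measurable).aestronglyMeasurable
  · rw [norm_real, tubeVolume, Real.norm_of_nonneg measureReal_nonneg]
    exact tubeVolume_le hbdd c ε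

open Classical in
/-- The tube volume is `p⁻¹ ∑ l`, over the components of length `l < ε`; integrated against `φ`, a
component of length `l` contributes `p⁻¹ l ∫_l^∞ φ`. -/
theorem hasSum_pairing_tubeVolume (hΩ : IsOpen Ω) (hbdd : Bornology.IsBounded Ω)
    {c : Set ℚ_[p] → ℚ_[p]} (hc : ∀ B ∈ components Ω, c B ∈ B) (hσ : abscissa Ω < 1)
    {φ : ℝ → ℂ} (hφ : Continuous φ) (hcs : HasCompactSupport φ) :
    HasSum (fun B : components Ω => (p : ℂ)⁻¹ * (len (B : Set ℚ_[p]) *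
        ∫ ε in Ioi (len (B : Set ℚ_[p])), φ ε))
      (pairing (fun ε => (tubeVolume Ω c ε : ℂ)) φ) := by
  have hcount : Countable (components Ω) := (countable_components hΩ hbdd).to_subtype
  have hint : Integrable φ := hφ.integrable_of_hasCompactSupport hcs
  have hlen : Summable fun B : components Ω => len (B : Set ℚ_[p]) := by
    simpa using summable_len_rpow hΩ hbdd (β := 1) (by exact_mod_cast hσ)
  set F : components Ω → ℝ → ℂ := fun B ε =>
    (Ioi (len (B : Set ℚ_[p]))).indicator
      (fun ε => (p : ℂ)⁻¹ * len (B : Set ℚ_[p]) * φ ε) ε with hF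
  have hFi : ∀ B, Integrable (F B) (volume.restrict (Ioi 0)) := fun B =>
    ((hint.const_mul _).indicator measurableSet_Ioi).restrict
  have hFn : ∀ B, ∫ ε in Ioi 0, ‖F B ε‖ ≤ len (B : Set ℚ_[p]) * ((p : ℝ)⁻¹ * ∫ ε, ‖φ ε‖) := by
    intro B
    have hl := (len_pos_of_mem_components hΩ hbdd B.2).le
    calc ∫ ε in Ioi 0, ‖F B ε‖ ≤ ∫ ε in Ioi (0 : ℝ), (p : ℝ)⁻¹ * len (B : Set ℚ_[p]) * ‖φ ε‖ := by
          refine integral_mono (hFi B).norm (hint.norm.const_mul _).restrict fun ε => ?_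
          refine (norm_indicator_le_norm_self _ _).trans_eq ?_
          rw [norm_mul, norm_mul, norm_inv, norm_natCast, norm_real, Real.norm_of_nonneg hl]
      _ ≤ ∫ ε, (p : ℝ)⁻¹ * len (B : Set ℚ_[p]) * ‖φ ε‖ :=
          setIntegral_le_integral (hint.norm.const_mul _) (ae_of_all _ fun ε => by positivity)
      _ = _ := by rw [integral_const_mul]; ring
  have key := hasSum_integral_of_summable_integral_norm hFi
    (Summable.of_nonneg_of_le (fun B => integral_nonneg fun _ => norm_nonneg _) hFn
      (hlen.mul_right _))
  have e : pairing (fun ε => (tubeVolume Ω c ε : ℂ)) φ =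
      ∫ ε in Ioi 0, ∑' B : components Ω, F B ε := by
    refine integral_congr_ae (ae_of_all _ fun ε => ?_)
    simp only [tubeVolume_eq_tsum hΩ hbdd hc, hF, ofReal_tsum, ← tsum_mul_right]
    refine tsum_congr fun B => ?_
    simp only [indicator, mem_Ioi]
    split_ifs <;> simp
  rw [e]
  refine Eq.subst (motive := fun G => HasSum G _) (funext fun B => Eq.symm ?_) key
  have hl := (len_pos_of_mem_components hΩ hbdd B.2).le
  simp only [hF]
  rw [setIntegral_indicator measurableSet_Ioi, Ioi_inter_Ioi, max_eq_right hl,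
    integral_const_mul, mul_assoc]

/-- The zeta function integrated against `testTransform φ` along a line of absolute convergence,
term by term, by Mellin inversion. -/
theorem hasSum_integral_zeta (hΩ : IsOpen Ω) (hbdd : Bornology.IsBounded Ω)
    {φ : ℝ → ℂ} {a : ℝ} (ha : 0 < a) (hφ : ContDiff ℝ (⊤ : ℕ∞) φ)
    (hcs : HasCompactSupport φ) (hv : ∀ x, a < x → φ x = 0) {c : ℝ}
    (hσc : abscissa Ω < (c : EReal)) (hc1 : c < 1) :
    HasSum (fun B : components Ω => (2 * Real.pi : ℂ) * (len (B : Set ℚ_[p]) *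
        ∫ ε in Ioi (len (B : Set ℚ_[p])), φ ε))
      (∫ t : ℝ, zetaSeries Ω (c + t * I) * testTransform φ (c + t * I)) := by
  have hcount : Countable (components Ω) := (countable_components hΩ hbdd).to_subtype
  have hM := integrable_testTransform_vertical ha hφ hcs hv hc1
  have hlen := summable_len_rpow hΩ hbdd hσc
  have hnorm : ∀ (B : components Ω) (t : ℝ),
      ‖(len (B : Set ℚ_[p]) : ℂ) ^ ((c : ℂ) + t * I)‖ = len (B : Set ℚ_[p]) ^ c := fun B t => by
    rw [norm_len_cpow hΩ hbdd]; simp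
  set F : components Ω → ℝ → ℂ := fun B t =>
    (len (B : Set ℚ_[p]) : ℂ) ^ ((c : ℂ) + t * I) * testTransform φ (c + t * I) with hF
  have hFi : ∀ B, Integrable (F B) := fun B => by
    have hl : (len (B : Set ℚ_[p]) : ℂ) ≠ 0 :=
      ofReal_ne_zero.2 (len_pos_of_mem_components hΩ hbdd B.2).ne'
    refine hM.bdd_mul (c := len (B : Set ℚ_[p]) ^ c) ?_ (ae_of_all _ fun t => (hnorm B t).le)
    exact (Continuous.const_cpow (by fun_prop) (Or.inl hl)).aestronglyMeasurable
  have key := hasSum_integral_of_summable_integral_norm hFi (by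
    refine (hlen.mul_right (∫ t : ℝ, ‖testTransform φ (c + t * I)‖)).congr fun B => ?_
    simp only [hF, norm_mul, hnorm]
    rw [integral_const_mul])
  have e : ∫ t : ℝ, zetaSeries Ω (c + t * I) * testTransform φ (c + t * I) =
      ∫ t : ℝ, ∑' B : components Ω, F B t := by
    refine integral_congr_ae (ae_of_all _ fun t => ?_)
    simp only [zetaSeries, hF, ← tsum_mul_right]
  rw [e]
  refine Eq.subst (motive := fun G => HasSum G _) (funext fun B => Eq.symm ?_) key
  rw [← integral_cpow_mul_testTransform ha hφ hcs hv hc1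
    (len_pos_of_mem_components hΩ hbdd B.2)]
  have : (2 * Real.pi : ℂ) ≠ 0 := by simp [Real.pi_ne_zero]
  rw [← mul_assoc, mul_one_div_cancel this, one_mul]

/-- The tube volume tested against `φ`, as a vertical line integral of the zeta function. -/
theorem pairing_tubeVolume_eq (hΩ : IsOpen Ω) (hbdd : Bornology.IsBounded Ω)
    {cen : Set ℚ_[p] → ℚ_[p]} (hc : ∀ B ∈ components Ω, cen B ∈ B) (hσ : abscissa Ω < 1)
    {φ : ℝ → ℂ} {a : ℝ} (ha : 0 < a) (hφ : ContDiff ℝ (⊤ : ℕ∞) φ)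
    (hcs : HasCompactSupport φ) (hv : ∀ x, a < x → φ x = 0) {c : ℝ}
    (hσc : abscissa Ω < (c : EReal)) (hc1 : c < 1) :
    ∫ t : ℝ, (p : ℂ)⁻¹ * zetaSeries Ω (c + t * I) * testTransform φ (c + t * I) =
      2 * Real.pi * pairing (fun ε => (tubeVolume Ω cen ε : ℂ)) φ := by
  have h1 := (hasSum_pairing_tubeVolume hΩ hbdd hc hσ hφ.continuous hcs).mul_left (2 * Real.pi : ℂ)
  have h2 := (hasSum_integral_zeta hΩ hbdd ha hφ hcs hv hσc hc1).mul_left (p : ℂ)⁻¹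
  simp only [mul_assoc]
  rw [integral_const_mul]
  refine h2.unique ?_
  simp only [← mul_assoc] at h1 ⊢
  convert h1 using 2
  ring

end

/-! ### Residue terms tested against a function -/

section

variable {φ : ℝ → ℂ} {f : ℂ → ℂ} {w : ℂ} {ρ a : ℝ}

theorem analyticAt_tubularZeta (p : ℕ) {ε : ℝ} (hε : 0 < ε) {z : ℂ} (hf : AnalyticAt ℂ f z)
    (hz : z.re < 1) : AnalyticAt ℂ (tubularZeta p f ε) z := by
  have hz1 : (1 : ℂ) - z ≠ 0 := fun h => by
    have := congrArg re h
    simp at this; linarith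
  have hε0 : (ε : ℂ) ≠ 0 := ofReal_ne_zero.2 hε.ne'
  have h1 : AnalyticAt ℂ (fun s : ℂ => (ε : ℂ) ^ (1 - s)) z := by
    have : Differentiable ℂ fun s : ℂ => (ε : ℂ) ^ (1 - s) := fun s =>
      DifferentiableAt.const_cpow (by fun_prop) (Or.inl hε0)
    exact this.analyticAt z
  exact ((analyticAt_const.mul hf).mul h1).div (analyticAt_const.sub analyticAt_id) hz1

/-- Fubini's theorem on a circle around `w` in the half-plane `Re s < 1`, in which no further
singularity lies. -/
theorem integrableOn_and_pairing_residueTerm_eq (p : ℕ) (hρ : 0 < ρ) (hw : w.re + ρ < 1)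
    (hf : ∀ z ∈ Metric.closedBall w ρ, z ≠ w → AnalyticAt ℂ f z)
    (hφ : Continuous φ) (hcs : HasCompactSupport φ) (hv : ∀ x, a < x → φ x = 0) :
    IntegrableOn (fun ε => residueTerm p f w ε * φ ε) (Ioi 0) ∧
      pairing (residueTerm p f w) φ =
        (2 * Real.pi * I)⁻¹ * ∮ z in C(w, ρ), (p : ℂ)⁻¹ * f z * testTransform φ z := by
  have hre : ∀ z ∈ Metric.closedBall w ρ, z.re < 1 ∧ (1 - z).re ≤ 1 - w.re + ρ := by
    intro z hz
    rw [mem_closedBall_iff_norm] at hz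
    have := (abs_re_le_norm (z - w)).trans hz
    rw [sub_re, abs_le] at this
    simp only [sub_re, one_re]
    constructor <;> linarith
  have hsph : ∀ θ : ℝ, circleMap w ρ θ ∈ Metric.closedBall w ρ := fun θ =>
    Metric.sphere_subset_closedBall (circleMap_mem_sphere w hρ.le θ)
  set k : ℝ → ℂ := fun θ => deriv (circleMap w ρ) θ *
    ((p : ℂ)⁻¹ * f (circleMap w ρ θ) / (1 - circleMap w ρ θ)) with hk
  have hkc : Continuous k := by
    have h1 : Continuous fun θ => f (circleMap w ρ θ) :=
      continuous_iff_continuousAt.2 fun θ => ContinuousAt.comp (f := circleMap w ρ)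
        (hf _ (hsph θ) (circleMap_ne_center hρ.ne')).continuousAt
        (continuous_circleMap w ρ).continuousAt
    have h2 : Continuous (deriv (circleMap w ρ)) := by
      have : deriv (circleMap w ρ) = fun θ => circleMap 0 ρ θ * I := by
        funext θ; exact deriv_circleMap w ρ θ
      rw [this]
      exact (continuous_circleMap 0 ρ).mul continuous_const
    refine h2.mul ((continuous_const.mul h1).div (continuous_const.sub (continuous_circleMap w ρ))
      fun θ h => ?_)
    have := congrArg re h
    have h3 := (hre _ (hsph θ)).1
    simp only [sub_re, one_re, zero_re] at this
    linarith
  set Ψ : ℝ × ℝ → ℂ := fun q => k q.2 * ((q.1 : ℂ) ^ (1 - circleMap w ρ q.2) * φ q.1) with hΨ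
  set E : ℝ := max 1 a ^ (1 - w.re + ρ) with hE
  have hφi : Integrable φ := hφ.integrable_of_hasCompactSupport hcs
  have hΨi : Integrable Ψ
      ((volume.restrict (Ioi 0)).prod (volume.restrict (Ioc 0 (2 * Real.pi)))) := by
    have hk1 : Integrable k (volume.restrict (Ioc 0 (2 * Real.pi))) :=
      (hkc.integrableOn_Icc (a := 0) (b := 2 * Real.pi)).mono_set Ioc_subset_Icc_self
    have hdom := (hφi.norm.const_mul E).restrict (s := Ioi 0).mul_prod hk1.norm
    refine hdom.mono' ?_ ?_
    · have : Measurable Ψ := by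
        have m1 : Measurable fun q : ℝ × ℝ => k q.2 := hkc.measurable.comp measurable_snd
        have m2 : Measurable fun q : ℝ × ℝ => φ q.1 := hφ.measurable.comp measurable_fst
        have m3 : Measurable fun q : ℝ × ℝ => (1 : ℂ) - circleMap w ρ q.2 :=
          measurable_const.sub ((continuous_circleMap w ρ).measurable.comp measurable_snd)
        exact m1.mul (((measurable_ofReal.comp measurable_fst).pow m3).mul m2)
      exact this.aestronglyMeasurable
    · rw [Measure.prod_restrict, ae_restrict_iff' (measurableSet_Ioi.prod measurableSet_Ioc)]
      refine ae_of_all _ fun q hq => ?_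
      have hq0 : 0 < q.1 := hq.1
      simp only [hΨ]
      rw [norm_mul, norm_mul (_ ^ _), mul_comm]
      refine mul_le_mul_of_nonneg_right ?_ (norm_nonneg _)
      rcases lt_or_ge a q.1 with h | h
      · simp [hv _ h]
      refine mul_le_mul_of_nonneg_right ?_ (norm_nonneg _)
      rw [norm_cpow_eq_rpow_re_of_pos hq0]
      obtain ⟨h1, h2⟩ := hre _ (hsph q.2)
      have h3 : 0 ≤ (1 - circleMap w ρ q.2).re := by
        rw [sub_re, one_re]; linarith
      exact (Real.rpow_le_rpow hq0.le (h.trans (le_max_right _ _)) h3).trans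
        (Real.rpow_le_rpow_of_exponent_le (le_max_left _ _) h2)
  have hterm : ∀ ε ∈ Ioi (0 : ℝ), residueTerm p f w ε * φ ε =
      (2 * Real.pi * I)⁻¹ * ∫ θ in Ioc 0 (2 * Real.pi), Ψ (ε, θ) := by
    intro ε hε
    rw [residueTerm, residue_eq_circleIntegral hρ fun z hz hzw =>
      analyticAt_tubularZeta p hε (hf z hz hzw) (hre z hz).1, circleIntegral,
      intervalIntegral.integral_of_le Real.two_pi_pos.le, mul_assoc, ← integral_mul_const]
    congr 1
    refine integral_congr_ae (ae_of_all _ fun θ => ?_)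
    simp only [hΨ, hk, tubularZeta, smul_eq_mul]
    ring
  constructor
  · refine (integrableOn_congr_fun hterm measurableSet_Ioi).2 ?_
    exact hΨi.integral_prod_left.const_mul _
  · rw [pairing, setIntegral_congr_fun measurableSet_Ioi hterm, integral_const_mul,
      integral_integral_swap hΨi, circleIntegral,
      intervalIntegral.integral_of_le Real.two_pi_pos.le]
    congr 1
    refine integral_congr_ae (ae_of_all _ fun θ => ?_)
    simp only [hΨ, hk]
    rw [integral_const_mul]
    simp only [testTransform, mellin, smul_eq_mul]
    have : ∀ t : ℝ, (t : ℂ) ^ (2 - circleMap w ρ θ - 1) = (t : ℂ) ^ (1 - circleMap w ρ θ) :=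
      fun t => by congr 1; ring
    simp only [this]
    ring

theorem exists_punctured_closedBall_analyticAt (hf : MeromorphicAt f w) (hw : w.re < 1) :
    ∃ ρ > 0, w.re + ρ < 1 ∧ ∀ z ∈ Metric.closedBall w ρ, z ≠ w → AnalyticAt ℂ f z := by
  have h := hf.eventually_analyticAt
  rw [eventually_nhdsWithin_iff] at h
  obtain ⟨r, hr, hb⟩ := Metric.eventually_nhds_iff_ball.1 h
  refine ⟨min (r / 2) ((1 - w.re) / 2), lt_min (by linarith) (by linarith), ?_, fun z hz hzw => ?_⟩
  · have := min_le_right (r / 2) ((1 - w.re) / 2)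
    linarith
  · refine hb z (Metric.closedBall_subset_ball ?_ hz) hzw
    have := min_le_left (r / 2) ((1 - w.re) / 2)
    linarith

theorem integrableOn_residueTerm_mul (p : ℕ) (hf : MeromorphicAt f w) (hw : w.re < 1)
    (hφ : Continuous φ) (hcs : HasCompactSupport φ) (hv : ∀ x, a < x → φ x = 0) :
    IntegrableOn (fun ε => residueTerm p f w ε * φ ε) (Ioi 0) := by
  obtain ⟨ρ, hρ, hwρ, h⟩ := exists_punctured_closedBall_analyticAt hf hw
  exact (integrableOn_and_pairing_residueTerm_eq p hρ hwρ h hφ hcs hv).1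

/-- Testing against `φ` commutes with taking residues, by Fubini's theorem on a small circle. -/
theorem pairing_residueTerm (p : ℕ) (hf : MeromorphicAt f w) (hw : w.re < 1)
    (hφ : Continuous φ) (hcs : HasCompactSupport φ) (hv : ∀ x, a < x → φ x = 0) :
    pairing (residueTerm p f w) φ =
      residue (fun z => (p : ℂ)⁻¹ * f z * testTransform φ z) w := by
  obtain ⟨ρ, hρ, hwρ, h⟩ := exists_punctured_closedBall_analyticAt hf hw
  rw [(integrableOn_and_pairing_residueTerm_eq p hρ hwρ h hφ hcs hv).2,
    residue_eq_circleIntegral hρ]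
  intro z hz hzw
  refine (analyticAt_const.mul (h z hz hzw)).mul (analyticAt_testTransform hφ hv ?_)
  rw [mem_closedBall_iff_norm] at hz
  have := (abs_re_le_norm (z - w)).trans hz
  rw [sub_re, abs_le] at this
  linarith

end

/-! ### The error term -/

theorem errorIntegrand_eq (p : ℕ) (f : ℂ → ℂ) (S : ℝ → ℝ) (φ : ℝ → ℂ) (t : ℝ) :
    errorIntegrand p f S φ t = (p : ℂ)⁻¹ * f (screenPoint S t) *
      testTransform φ (screenPoint S t) * (((deriv S t : ℝ) : ℂ) + I) := by
  rw [errorIntegrand, pairing_tubularZeta]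

theorem screenPoint_re (S : ℝ → ℝ) (t : ℝ) : (screenPoint S t).re = S t := by simp [screenPoint]

theorem screenPoint_im (S : ℝ → ℝ) (t : ℝ) : (screenPoint S t).im = t := by simp [screenPoint]

theorem bddAbove_range_of_isScreen {S : ℝ → ℝ} (hS : IsScreen S) : BddAbove (range S) := by
  obtain ⟨M, hM⟩ := hS.bounded
  exact ⟨M, by rintro _ ⟨t, rfl⟩; exact (abs_le.1 (hM t)).2⟩

/-- Dilating the test function by `a` multiplies the error integrand at `s` by `a ^ (1 - s)`, and
`a ^ (1 - Re s) ≤ a ^ (1 - sup S)` for `a ≤ 1`. -/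
theorem isBigO_errorTerm_dilate {p : ℕ} {φ : ℝ → ℂ} {f : ℂ → ℂ} {S : ℝ → ℝ} (hS : IsScreen S)
    (hint : Integrable (errorIntegrand p f S φ)) :
    (fun a : ℝ => errorTerm p f S (dilate φ a)) =O[𝓝[>] 0]
      (fun a : ℝ => a ^ (1 - ⨆ t, S t)) := by
  have hbdd := bddAbove_range_of_isScreen hS
  refine Asymptotics.IsBigO.of_bound
    (‖(2 * Real.pi * I : ℂ)⁻¹‖ * ∫ t, ‖errorIntegrand p f S φ t‖) ?_
  filter_upwards [Ioo_mem_nhdsGT (zero_lt_one (α := ℝ))] with b hb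
  have hpt : ∀ t, ‖errorIntegrand p f S (dilate φ b) t‖ ≤
      b ^ (1 - ⨆ t, S t) * ‖errorIntegrand p f S φ t‖ := by
    intro t
    have e : errorIntegrand p f S (dilate φ b) t =
        (b : ℂ) ^ (1 - screenPoint S t) * errorIntegrand p f S φ t := by
      rw [errorIntegrand_eq, errorIntegrand_eq, testTransform_dilate φ hb.1]
      ring
    rw [e, norm_mul, norm_cpow_eq_rpow_re_of_pos hb.1, sub_re, one_re, screenPoint_re]
    refine mul_le_mul_of_nonneg_right ?_ (norm_nonneg _)
    exact Real.rpow_le_rpow_of_exponent_ge hb.1 hb.2.le (by linarith [le_ciSup hbdd t])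
  have hle : ‖∫ t, errorIntegrand p f S (dilate φ b) t‖ ≤
      ∫ t, b ^ (1 - ⨆ t, S t) * ‖errorIntegrand p f S φ t‖ :=
    norm_integral_le_of_norm_le (hint.norm.const_mul _) (ae_of_all _ hpt)
  rw [integral_const_mul] at hle
  rw [errorTerm, norm_mul, Real.norm_of_nonneg (Real.rpow_nonneg hb.1.le _)]
  calc _ ≤ ‖(2 * Real.pi * I : ℂ)⁻¹‖ *
        (b ^ (1 - ⨆ t, S t) * ∫ t, ‖errorIntegrand p f S φ t‖) := by gcongr
    _ = _ := by ring

/-! ### Estimates along the sides of the contour -/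

theorem rpow_mul_inv_pow_le {x κ : ℝ} (hx : 1 ≤ x) {k : ℕ} (hk : κ + 2 ≤ k) :
    x ^ κ * (x ^ k)⁻¹ ≤ (x ^ 2)⁻¹ := by
  have h0 : 0 < x := by linarith
  rw [← Real.rpow_natCast x k, ← Real.rpow_neg h0.le, ← Real.rpow_add h0,
    ← Real.rpow_natCast x 2, ← Real.rpow_neg h0.le]
  refine Real.rpow_le_rpow_of_exponent_le hx ?_
  push_cast
  linarith

/-- `testTransform φ` beats every power of the height, with an integrable margin. -/
theorem exists_rpow_mul_norm_testTransform_le {φ : ℝ → ℂ} {a : ℝ} (ha : 0 < a)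
    (hφ : ContDiff ℝ (⊤ : ℕ∞) φ) (hcs : HasCompactSupport φ) (hv : ∀ x, a < x → φ x = 0) {c : ℝ}
    (hc1 : c < 1) (κ : ℝ) :
    ∃ C : ℝ, 0 ≤ C ∧ ∀ s : ℂ, s.re ≤ c →
      (|s.im| + 1) ^ κ * ‖testTransform φ s‖ ≤ C * a ^ (-s.re) * ((1 + |s.im|) ^ 2)⁻¹ := by
  obtain ⟨k, hk⟩ := exists_nat_ge (κ + 2)
  obtain ⟨C, hC0, hC⟩ := exists_norm_testTransform_le ha hφ hcs hv hc1 k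
  refine ⟨C, hC0, fun s hs => ?_⟩
  have h1 : 1 ≤ 1 + |s.im| := by linarith [abs_nonneg s.im]
  rw [add_comm |s.im| 1]
  calc (1 + |s.im|) ^ κ * ‖testTransform φ s‖
      ≤ (1 + |s.im|) ^ κ * (C * a ^ (-s.re) * ((1 + |s.im|) ^ k)⁻¹) := by
        gcongr; exact hC s hs
    _ = C * a ^ (-s.re) * ((1 + |s.im|) ^ κ * ((1 + |s.im|) ^ k)⁻¹) := by ring
    _ ≤ _ := by
        refine mul_le_mul_of_nonneg_left (rpow_mul_inv_pow_le h1 hk) ?_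
        exact mul_nonneg hC0 (Real.rpow_nonneg ha.le _)

theorem exists_rpow_neg_le {a : ℝ} (ha : 0 < a) (M c : ℝ) :
    ∃ E : ℝ, 0 ≤ E ∧ ∀ u ∈ Icc (-M) c, a ^ (-u) ≤ E := by
  have hcont : Continuous fun u : ℝ => a ^ (-u) :=
    Continuous.rpow continuous_const continuous_neg fun _ => Or.inl ha.ne'
  obtain ⟨E, hE⟩ := (isCompact_Icc (a := -M) (b := c)).exists_bound_of_continuousOn
    hcont.continuousOn
  refine ⟨max E 0, le_max_right _ _, fun u hu => ?_⟩
  exact (le_abs_self _).trans ((hE u hu).trans (le_max_left _ _))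

theorem tendsto_inv_one_add_abs_sq {T : ℕ → ℝ} (hT : Tendsto (fun n => |T n|) atTop atTop) :
    Tendsto (fun n => ((1 + |T n|) ^ 2)⁻¹) atTop (𝓝 0) :=
  ((tendsto_pow_atTop two_ne_zero).comp (tendsto_atTop_add_const_left _ 1 hT)).inv_tendsto_atTop

section

variable {p : ℕ} [Fact p.Prime]

theorem norm_prime_inv_mul_le (x y : ℂ) : ‖(p : ℂ)⁻¹ * x * y‖ ≤ ‖x‖ * ‖y‖ := by
  rw [norm_mul, norm_mul, norm_inv, norm_natCast]
  refine mul_le_mul_of_nonneg_right ?_ (norm_nonneg _)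
  exact mul_le_of_le_one_left (norm_nonneg _)
    (inv_le_one_of_one_le₀ (one_lt_prime_cast (p := p)).le)

/-- The horizontal sides of the contour: the polynomial growth of `f` at the heights `T n` is beaten
by the rapid decay of `testTransform φ`. -/
theorem tendsto_integral_horizontal {f : ℂ → ℂ} {φ : ℝ → ℂ} {a : ℝ} (ha : 0 < a)
    (hφ : ContDiff ℝ (⊤ : ℕ∞) φ) (hcs : HasCompactSupport φ) (hv : ∀ x, a < x → φ x = 0) {c : ℝ}
    (hc1 : c < 1) {S : ℝ → ℝ} {M : ℝ} (hM : ∀ t, |S t| ≤ M) (hSc : ∀ t, S t ≤ c) {κ C : ℝ}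
    (hC : 0 < C) {T : ℕ → ℝ} (hT : Tendsto (fun n => |T n|) atTop atTop)
    (hf : ∀ (n : ℕ) (u : ℝ), S (T n) ≤ u → ‖f ((u : ℂ) + T n * I)‖ ≤ C * (|T n| + 1) ^ κ) :
    Tendsto (fun n => ∫ u in S (T n)..c,
      (p : ℂ)⁻¹ * f ((u : ℂ) + T n * I) * testTransform φ ((u : ℂ) + T n * I)) atTop (𝓝 0) := by
  obtain ⟨D, hD0, hD⟩ := exists_rpow_mul_norm_testTransform_le ha hφ hcs hv hc1 κ
  obtain ⟨E, hE0, hE⟩ := exists_rpow_neg_le ha M c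
  have hlim := (tendsto_inv_one_add_abs_sq hT).const_mul (C * (D * E) * (c + M))
  rw [mul_zero] at hlim
  refine squeeze_zero_norm (fun n => ?_) hlim
  have hSM := abs_le.1 (hM (T n))
  have hb : ∀ u ∈ uIoc (S (T n)) c,
      ‖(p : ℂ)⁻¹ * f ((u : ℂ) + T n * I) * testTransform φ ((u : ℂ) + T n * I)‖ ≤
        C * (D * E) * ((1 + |T n|) ^ 2)⁻¹ := by
    intro u hu
    rw [uIoc_of_le (hSc _)] at hu
    have h1 := hD ((u : ℂ) + T n * I) (by simpa using hu.2)
    simp only [add_re, ofReal_re, mul_re, I_re, mul_zero, ofReal_im, I_im, mul_one, sub_self,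
      add_zero, add_im, mul_im, zero_add] at h1
    have h2 := hE u ⟨by linarith [hu.1], hu.2⟩
    calc _ ≤ ‖f ((u : ℂ) + T n * I)‖ * ‖testTransform φ ((u : ℂ) + T n * I)‖ :=
          norm_prime_inv_mul_le _ _
      _ ≤ C * (|T n| + 1) ^ κ * ‖testTransform φ ((u : ℂ) + T n * I)‖ := by
          gcongr; exact hf n u hu.1.le
      _ = C * ((|T n| + 1) ^ κ * ‖testTransform φ ((u : ℂ) + T n * I)‖) := by ring
      _ ≤ C * (D * a ^ (-u) * ((1 + |T n|) ^ 2)⁻¹) := by gcongr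
      _ ≤ C * (D * E * ((1 + |T n|) ^ 2)⁻¹) := by gcongr
      _ = _ := by ring
  refine (intervalIntegral.norm_integral_le_of_norm_le_const hb).trans ?_
  rw [abs_of_nonneg (sub_nonneg.2 (hSc _))]
  have h0 : 0 ≤ C * (D * E) * ((1 + |T n|) ^ 2)⁻¹ := by positivity
  calc _ ≤ C * (D * E) * ((1 + |T n|) ^ 2)⁻¹ * (c + M) :=
        mul_le_mul_of_nonneg_left (by linarith) h0
    _ = _ := by ring

/-- If `|f|` is at most `Q (|t| + 1) ^ κ` at height `t` of the screen, the error integrand is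
dominated by a fixed integrable function. The constant `D` depends on the screen only through an
upper bound `c` and a Lipschitz constant. -/
theorem exists_norm_errorIntegrand_le {φ : ℝ → ℂ} {a : ℝ} (ha : 0 < a)
    (hφ : ContDiff ℝ (⊤ : ℕ∞) φ) (hcs : HasCompactSupport φ) (hv : ∀ x, a < x → φ x = 0) {c : ℝ}
    (hc1 : c < 1) (κ : ℝ) (K : ℝ≥0) :
    ∃ D : ℝ, 0 ≤ D ∧ ∀ (f : ℂ → ℂ) (S : ℝ → ℝ), LipschitzWith K S → (∀ t, S t ≤ c) →
      ∀ (Q t : ℝ), ‖f (screenPoint S t)‖ ≤ Q * (|t| + 1) ^ κ →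
        ‖errorIntegrand p f S φ t‖ ≤ D * (Q * a ^ (-S t)) * ((1 + |t|) ^ 2)⁻¹ := by
  obtain ⟨D, hD0, hD⟩ := exists_rpow_mul_norm_testTransform_le ha hφ hcs hv hc1 κ
  refine ⟨D * (K + 1), by positivity, fun f S hS hSc Q t hf => ?_⟩
  have hQ : 0 ≤ Q := by
    have h1 : 0 < (|t| + 1) ^ κ := Real.rpow_pos_of_pos (by positivity) _
    exact nonneg_of_mul_nonneg_left ((norm_nonneg _).trans hf) h1
  have h1 := hD (screenPoint S t) (by rw [screenPoint_re]; exact hSc t)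
  rw [screenPoint_re, screenPoint_im] at h1
  rw [errorIntegrand_eq, norm_mul]
  calc _ ≤ ‖f (screenPoint S t)‖ * ‖testTransform φ (screenPoint S t)‖ * (K + 1) := by
        gcongr
        · exact norm_prime_inv_mul_le _ _
        · exact norm_screenDeriv_le hS t
    _ ≤ Q * (|t| + 1) ^ κ * ‖testTransform φ (screenPoint S t)‖ * (K + 1) := by gcongr
    _ = Q * ((|t| + 1) ^ κ * ‖testTransform φ (screenPoint S t)‖) * (K + 1) := by ring
    _ ≤ Q * (D * a ^ (-S t) * ((1 + |t|) ^ 2)⁻¹) * (K + 1) := by gcongr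
    _ = _ := by ring

theorem integrable_errorIntegrand {φ : ℝ → ℂ} {a : ℝ} (ha : 0 < a)
    (hφ : ContDiff ℝ (⊤ : ℕ∞) φ) (hcs : HasCompactSupport φ) (hv : ∀ x, a < x → φ x = 0)
    {f : ℂ → ℂ} {S : ℝ → ℝ} (hS : IsScreen S) {c : ℝ} (hSc : ∀ t, S t ≤ c) (hc1 : c < 1)
    (hf : ∀ t, AnalyticAt ℂ f (screenPoint S t)) {κ Q : ℝ}
    (hQ : ∀ t, ‖f (screenPoint S t)‖ ≤ Q * (|t| + 1) ^ κ) :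
    Integrable (errorIntegrand p f S φ) := by
  obtain ⟨K, hK⟩ := hS.lipschitz
  obtain ⟨M, hM⟩ := hS.bounded
  obtain ⟨D, hD0, hD⟩ := exists_norm_errorIntegrand_le (p := p) ha hφ hcs hv hc1 κ K
  obtain ⟨E, hE0, hE⟩ := exists_rpow_neg_le ha M c
  have hQ0 : 0 ≤ Q := by simpa using (norm_nonneg _).trans (hQ 0)
  have hcont : Continuous fun t => (p : ℂ)⁻¹ * f (screenPoint S t) *
      testTransform φ (screenPoint S t) := by
    have hs := (lipschitzWith_screenPoint hK).continuous
    refine continuous_iff_continuousAt.2 fun t => ContinuousAt.mul (continuousAt_const.mul ?_) ?_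
    · exact ContinuousAt.comp (f := screenPoint S) (hf t).continuousAt hs.continuousAt
    · have h : AnalyticAt ℂ (testTransform φ) (screenPoint S t) :=
        analyticAt_testTransform hφ.continuous hv
          (by rw [screenPoint_re]; exact (hSc t).trans_lt hc1)
      exact ContinuousAt.comp (f := screenPoint S) h.continuousAt hs.continuousAt
  refine (integrable_inv_one_add_abs_sq.const_mul (D * (Q * E))).mono' ?_ (ae_of_all _ fun t => ?_)
  · have : errorIntegrand p f S φ = fun t => (p : ℂ)⁻¹ * f (screenPoint S t) *
        testTransform φ (screenPoint S t) * (((deriv S t : ℝ) : ℂ) + I) :=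
      funext fun t => errorIntegrand_eq p f S φ t
    rw [this]
    exact (hcont.measurable.mul (measurable_screenDeriv S)).aestronglyMeasurable
  · refine (hD f S hK hSc Q t (hQ t)).trans ?_
    have := hE (S t) ⟨(abs_le.1 (hM t)).1, hSc t⟩
    gcongr

/-! ### The tube formula on a window -/

/-- The tube formula, tested against `φ`, on the window of one screen: the residue theorem between
the screen and a vertical line on which the zeta series converges absolutely. -/
theorem tendsto_truncatedSum {Ω : Set ℚ_[p]} (hΩ : IsOpen Ω) (hbdd : Bornology.IsBounded Ω)
    {cen : Set ℚ_[p] → ℚ_[p]} (hcen : ∀ B ∈ components Ω, cen B ∈ B) (hσ : abscissa Ω < 1)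
    {S : ℝ → ℝ} (hS : IsScreen S) (hsup : (⨆ t, S t) < 1) {U : Set ℂ} {f : ℂ → ℂ}
    (hf : IsContinuation Ω U f) (hW : window S ⊆ U) (hnp : ∀ t, ¬ IsPole f (screenPoint S t))
    {T : ℤ → ℝ} (hT : IsHeights T) {κ C : ℝ} (hC : 0 < C)
    (hhor : ∀ (n : ℤ) (u : ℝ), S (T n) ≤ u →
      BoundAt f ((u : ℂ) + (T n : ℂ) * I) (C * (|T n| + 1) ^ κ))
    {φ : ℝ → ℂ} {a : ℝ} (ha : 0 < a) (hφ : ContDiff ℝ (⊤ : ℕ∞) φ)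
    (hcs : HasCompactSupport φ) (hv : ∀ x, a < x → φ x = 0)
    (hint : Integrable (errorIntegrand p f S φ)) :
    Tendsto (truncatedSum p f (visibleDimensions f (window S)) T φ) atTop
      (𝓝 (pairing (fun ε => (tubeVolume Ω cen ε : ℂ)) φ - errorTerm p f S φ)) := by
  obtain ⟨K, hK⟩ := hS.lipschitz
  obtain ⟨M, hM⟩ := hS.bounded
  have hbS := bddAbove_range_of_isScreen hS
  -- a vertical line in the half-plane of convergence, to the right of the screen
  obtain ⟨c, hσc, hSc, hc1⟩ : ∃ c : ℝ, abscissa Ω < (c : EReal) ∧ (⨆ t, S t) < c ∧ c < 1 := by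
    obtain ⟨c₀, h1, h2⟩ := EReal.lt_iff_exists_real_btwn.1 hσ
    have h2' : c₀ < 1 := by exact_mod_cast h2
    obtain ⟨c, h3, h4⟩ := exists_between (max_lt h2' hsup)
    exact ⟨c, h1.trans (EReal.coe_lt_coe_iff.2 ((le_max_left _ _).trans_lt h3)),
      (le_max_right _ _).trans_lt h3, h4⟩
  have hSc' : ∀ t, S t < c := fun t => (le_ciSup hbS t).trans_lt hSc
  set g : ℂ → ℂ := fun z => (p : ℂ)⁻¹ * f z * testTransform φ z with hg
  have hgan : ∀ z ∈ U, z.re < 1 → ¬ IsPole f z → AnalyticAt ℂ g z := fun z hz hz1 hp =>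
    (analyticAt_const.mul (analyticAt_of_not_isPole hf hz hp)).mul
      (analyticAt_testTransform hφ.continuous hv hz1)
  have hpoleU : ∀ w ∈ visibleDimensions f (window S), w.re < c := fun w hw =>
    re_lt_of_isPole hΩ hbdd hf (hW hw.1) hw.2 hσc
  have hmer : ∀ w ∈ visibleDimensions f (window S), MeromorphicAt f w := fun w hw =>
    (hf.meromorphic (hW hw.1)).meromorphicAt
  -- the residue theorem
  have hres : ∀ᶠ n : ℕ in atTop, (2 * Real.pi * I)⁻¹ *
      boundaryIntegral S (T (-n)) (T n) c g =
        truncatedSum p f (visibleDimensions f (window S)) T φ n := by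
    filter_upwards [eventually_ge_atTop 1] with n hn
    have hfin := finite_visibleDimensions_strip hΩ hbdd hσ hf hS hW (T (-n)) (T n)
    have hD : ∀ w ∈ hfin.toFinset, w ∈ visibleDimensions f (window S) ∧ T (-n) < w.im ∧
        w.im < T n := fun w hw => hfin.mem_toFinset.1 hw
    have hbi := boundaryIntegral_eq_sum_residue hK (a := T (-n)) (b := T n) (c := c)
      ((hT.neg n hn).trans (hT.pos n hn)).le (fun t _ => (hSc' t).le) hfin.toFinset g
      (fun w hw => by
        obtain ⟨h1, h2, h3⟩ := hD w hw
        refine ⟨h2, h3, lt_of_le_of_ne h1.1 fun h => ?_, hpoleU w h1⟩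
        have : screenPoint S w.im = w := by rw [screenPoint, h, re_add_im]
        exact hnp w.im (by rw [this]; exact h1.2))
      (fun w hw => by
        obtain ⟨h1, -, -⟩ := hD w hw
        exact ((MeromorphicAt.const _ _).mul (hmer w h1)).mul
          (analyticAt_testTransform hφ.continuous hv ((hpoleU w h1).trans hc1)).meromorphicAt)
      (fun z hz1 hz2 hzD => by
        refine hgan z (hW hz2.1) (hz2.2.trans_lt hc1) fun hp => ?_
        rcases hz1.1.eq_or_lt with h | h
        · refine (hhor (-n) z.re (by rw [h]; exact hz2.1)).1 ?_
          rwa [h, re_add_im]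
        rcases hz1.2.eq_or_lt with h' | h'
        · refine (hhor n z.re (by rw [← h']; exact hz2.1)).1 ?_
          rwa [← h', re_add_im]
        exact hzD (hfin.mem_toFinset.2 ⟨⟨hz2.1, hp⟩, h, h'⟩))
    have h2π : (2 * Real.pi * I : ℂ) ≠ 0 := by simp [Real.pi_ne_zero]
    rw [hbi, inv_mul_cancel_left₀ h2π, truncatedSum, finsum_mem_eq_finite_toFinset_sum _ hfin]
    refine Finset.sum_congr rfl fun w hw => ?_
    obtain ⟨h1, -, -⟩ := hD w hw
    exact (pairing_residueTerm p (hmer w h1) ((hpoleU w h1).trans hc1) hφ.continuous hcs hv).symm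
  refine Tendsto.congr' hres ?_
  -- the two horizontal sides vanish in the limit
  have htop : Tendsto (fun n : ℕ => |T n|) atTop atTop :=
    tendsto_abs_atTop_atTop.comp hT.tendsto_top
  have hbot : Tendsto (fun n : ℕ => |T (-n)|) atTop atTop :=
    tendsto_abs_atBot_atTop.comp hT.tendsto_bot
  have l1 := tendsto_integral_horizontal (p := p) (f := f) ha hφ hcs hv hc1 hM
    (fun t => (hSc' t).le) hC hbot fun n u hu => (hhor (-n) u hu).2
  have l3 := tendsto_integral_horizontal (p := p) (f := f) ha hφ hcs hv hc1 hM
    (fun t => (hSc' t).le) hC htop fun n u hu => (hhor n u hu).2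
  -- the line in the half-plane of convergence gives the tube volume
  have hlineU : ∀ t : ℝ, (c : ℂ) + t * I ∈ U := fun t => hW (by
    have := (hSc' t).le
    simpa [window] using this)
  have hlinere : ∀ t : ℝ, abscissa Ω < ((((c : ℂ) + t * I).re : ℝ) : EReal) := fun t => by
    simpa using hσc
  have hfline : ∀ t : ℝ, f (c + t * I) = zetaSeries Ω (c + t * I) := fun t =>
    hf.eq_series _ (hlineU t) (hlinere t)
  have hgline : Integrable fun t : ℝ => g (c + t * I) := by
    have hb : ∀ t : ℝ, ‖(p : ℂ)⁻¹ * f (c + t * I)‖ ≤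
        ‖(p : ℂ)⁻¹‖ * ∑' B : components Ω, len (B : Set ℚ_[p]) ^ c := fun t => by
      rw [norm_mul, hfline]
      refine mul_le_mul_of_nonneg_left ?_ (norm_nonneg _)
      simpa using norm_zetaSeries_le hΩ hbdd (hlinere t)
    refine (integrable_testTransform_vertical ha hφ hcs hv hc1).bdd_mul ?_ (ae_of_all _ hb)
    refine (continuous_const.mul (continuous_iff_continuousAt.2 fun t => ?_)).aestronglyMeasurable
    exact ContinuousAt.comp (f := fun t : ℝ => (c : ℂ) + t * I) (analyticAt_of_not_isPole hf
      (hlineU t) (not_isPole_of_abscissa_lt hΩ hbdd hf (hlineU t) (hlinere t))).continuousAt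
      (by fun_prop)
  have l2 := intervalIntegral_tendsto_integral hgline hT.tendsto_bot hT.tendsto_top
  have l4 := intervalIntegral_tendsto_integral hint hT.tendsto_bot hT.tendsto_top
  have hline : ∫ t : ℝ, g (c + t * I) =
      2 * Real.pi * pairing (fun ε => (tubeVolume Ω cen ε : ℂ)) φ := by
    rw [← pairing_tubeVolume_eq hΩ hbdd hcen hσ ha hφ hcs hv hσc hc1]
    simp only [hg, hfline]
  have hall := (((l1.add (l2.mul_const I)).sub l3).sub l4).const_mul (2 * Real.pi * I : ℂ)⁻¹
  have hlim : (2 * Real.pi * I : ℂ)⁻¹ * (0 + (∫ t : ℝ, g (c + t * I)) * I - 0 -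
      ∫ t, errorIntegrand p f S φ t) =
      pairing (fun ε => (tubeVolume Ω cen ε : ℂ)) φ - errorTerm p f S φ := by
    rw [hline, errorTerm]
    have h2π : (2 * Real.pi * I : ℂ) ≠ 0 := by simp [Real.pi_ne_zero]
    field_simp
    ring
  rw [← hlim]
  refine hall.congr fun n => ?_
  simp only [boundaryIntegral, hg, errorIntegrand_eq]

end

/-! ### The tube formula -/

/-- A compactly supported function with support to the left of `b` vanishes beyond some `a < b`. -/
theorem exists_pos_lt_vanishing {φ : ℝ → ℂ} (hcs : HasCompactSupport φ) {b : ℝ} (hb : 0 < b)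
    (hsupp : tsupport φ ⊆ Iio b) : ∃ a, 0 < a ∧ a < b ∧ ∀ x, a < x → φ x = 0 := by
  rcases (tsupport φ).eq_empty_or_nonempty with h | h
  · exact ⟨b / 2, by linarith, by linarith,
      fun x _ => image_eq_zero_of_notMem_tsupport (by simp [h])⟩
  · obtain ⟨m, hm, hmax⟩ := (show IsCompact (tsupport φ) from hcs).exists_isGreatest h
    refine ⟨max m (b / 2), lt_max_of_lt_right (by linarith), max_lt (hsupp hm) (by linarith),
      fun x hx => image_eq_zero_of_notMem_tsupport fun hmem => ?_⟩
    exact absurd (hmax hmem) (not_le.2 ((le_max_left _ _).trans_lt hx))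

/-- The bound `C |t| ^ κ` for `|t| ≥ 1` along a screen without poles gives a bound of the form
`Q (|t| + 1) ^ κ` for all `t`. -/
theorem exists_norm_screen_le {f : ℂ → ℂ} {S : ℝ → ℝ} (hS : IsScreen S)
    (hf : ∀ t, AnalyticAt ℂ f (screenPoint S t)) {κ C : ℝ} (hC : 0 < C)
    (h : ∀ t : ℝ, 1 ≤ |t| → ‖f (screenPoint S t)‖ ≤ C * |t| ^ κ) :
    ∃ Q : ℝ, ∀ t, ‖f (screenPoint S t)‖ ≤ Q * (|t| + 1) ^ κ := by
  obtain ⟨K, hK⟩ := hS.lipschitz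
  have hpos : ∀ t : ℝ, 0 < (|t| + 1) ^ κ := fun t => Real.rpow_pos_of_pos (by positivity) _
  have hcont : Continuous fun t => f (screenPoint S t) := continuous_iff_continuousAt.2 fun t =>
    ContinuousAt.comp (f := screenPoint S) (hf t).continuousAt
      (lipschitzWith_screenPoint hK).continuous.continuousAt
  have hcont2 : Continuous fun t : ℝ => (|t| + 1) ^ κ :=
    Continuous.rpow_const (by fun_prop) fun t => Or.inl (by positivity)
  obtain ⟨B, hB⟩ := (isCompact_Icc (a := (-1 : ℝ)) (b := 1)).exists_bound_of_continuousOn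
    (f := fun t => f (screenPoint S t) / (((|t| + 1) ^ κ : ℝ) : ℂ))
    (hcont.div (continuous_ofReal.comp hcont2) fun t =>
      ofReal_ne_zero.2 (hpos t).ne').continuousOn
  refine ⟨max B (C * max 1 (2 ^ (-κ))), fun t => ?_⟩
  rcases le_total 1 |t| with ht | ht
  · have h0 : 0 < |t| := by linarith
    refine (h t ht).trans ?_
    have hle : |t| ^ κ ≤ max 1 (2 ^ (-κ)) * (|t| + 1) ^ κ := by
      rcases le_total 0 κ with hκ | hκ
      · have h1 : |t| ^ κ ≤ (|t| + 1) ^ κ := Real.rpow_le_rpow h0.le (by linarith) hκ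
        exact h1.trans (le_mul_of_one_le_left (hpos t).le (le_max_left _ _))
      · -- here `|t| + 1 ≤ 2 |t|` and the exponent is negative
        have h1 : (2 * |t|) ^ κ ≤ (|t| + 1) ^ κ :=
          Real.rpow_le_rpow_of_nonpos (by linarith) (by linarith) hκ
        have h2 : |t| ^ κ = 2 ^ (-κ) * (2 * |t|) ^ κ := by
          rw [Real.mul_rpow two_pos.le h0.le, ← mul_assoc, ← Real.rpow_add two_pos]
          simp
        rw [h2]
        exact mul_le_mul (le_max_right _ _) h1 (Real.rpow_nonneg (by linarith) _) (by positivity)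
    calc C * |t| ^ κ ≤ C * (max 1 (2 ^ (-κ)) * (|t| + 1) ^ κ) := by gcongr
      _ = C * max 1 (2 ^ (-κ)) * (|t| + 1) ^ κ := by ring
      _ ≤ _ := mul_le_mul_of_nonneg_right (le_max_right _ _) (hpos t).le
  · have h1 := hB t (abs_le.1 ht)
    rw [norm_div, norm_real, Real.norm_of_nonneg (hpos t).le, div_le_iff₀ (hpos t)] at h1
    exact h1.trans (mul_le_mul_of_nonneg_right (le_max_left _ _) (hpos t).le)

/-- Moving the screens off to `-∞` makes the error terms vanish when the test function is
supported to the left of `A⁻¹`: the bound `A ^ |S m t|` is beaten by `a ^ (-S m t)`. -/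
theorem tendsto_errorTerm_zero {p : ℕ} [Fact p.Prime] {S : ℕ → ℝ → ℝ} {f : ℂ → ℂ} {κ A C : ℝ}
    {T : ℤ → ℝ} (hL : IsStronglyLanguid f S κ A C T) {φ : ℝ → ℂ} {a : ℝ} (ha : 0 < a)
    (haA : a < A⁻¹) (hφ : ContDiff ℝ (⊤ : ℕ∞) φ) (hcs : HasCompactSupport φ)
    (hv : ∀ x, a < x → φ x = 0) :
    Tendsto (fun m => errorTerm p f (S m) φ) atTop (𝓝 0) := by
  obtain ⟨K, hK⟩ := hL.lipschitz
  obtain ⟨D, hD0, hD⟩ := exists_norm_errorIntegrand_le (p := p) ha hφ hcs hv zero_lt_one κ K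
  have hA := hL.base_pos
  have hC := hL.const_pos
  have hAa1 : A * a < 1 := by
    rw [lt_inv_comm₀ ha hA, inv_eq_one_div, lt_div_iff₀ ha] at haA
    exact haA
  have hAa0 : 0 < A * a := mul_pos hA ha
  set J : ℝ := ∫ t : ℝ, ((1 + |t|) ^ 2)⁻¹
  have hlim : Tendsto (fun m => ‖(2 * Real.pi * I : ℂ)⁻¹‖ *
      (D * (C * (A * a) ^ (-⨆ t, S m t)) * J)) atTop (𝓝 0) := by
    have h1 : Tendsto (fun m => (A * a) ^ (-⨆ t, S m t)) atTop (𝓝 0) :=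
      (tendsto_rpow_atTop_of_base_lt_one _ (by linarith) hAa1).comp
        (tendsto_neg_atBot_atTop.comp hL.sup_tendsto)
    simpa using (((h1.const_mul C).const_mul D).mul_const J).const_mul ‖(2 * Real.pi * I : ℂ)⁻¹‖
  refine squeeze_zero_norm' ?_ hlim
  filter_upwards [hL.sup_tendsto.eventually_le_atBot 0] with m hm
  have hle : ∀ t, S m t ≤ ⨆ t, S m t := le_ciSup (bddAbove_range_of_isScreen (hL.screens m))
  have hpt : ∀ t, ‖errorIntegrand p f (S m) φ t‖ ≤
      D * (C * (A * a) ^ (-⨆ t, S m t)) * ((1 + |t|) ^ 2)⁻¹ := by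
    intro t
    have hS0 : S m t ≤ 0 := (hle t).trans hm
    refine (hD f (S m) (hK m) (fun t => (hle t).trans hm) _ t (hL.vertical m t).2).trans ?_
    rw [abs_of_nonpos hS0, mul_assoc C, ← Real.mul_rpow hA.le ha.le]
    have : (A * a) ^ (-S m t) ≤ (A * a) ^ (-⨆ t, S m t) :=
      Real.rpow_le_rpow_of_exponent_ge hAa0 hAa1.le (neg_le_neg (hle t))
    gcongr
  have h2 : ‖∫ t, errorIntegrand p f (S m) φ t‖ ≤
      ∫ t : ℝ, D * (C * (A * a) ^ (-⨆ t, S m t)) * ((1 + |t|) ^ 2)⁻¹ :=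
    norm_integral_le_of_norm_le (integrable_inv_one_add_abs_sq.const_mul _) (ae_of_all _ hpt)
  rw [integral_const_mul] at h2
  rw [errorTerm, norm_mul]
  exact mul_le_mul_of_nonneg_left h2 (norm_nonneg _)

end PadicString

theorem theorem3p15 (p : ℕ) [Fact p.Prime] (Ω : Set ℚ_[p]) (hΩ : IsOpen Ω)
    (hbdd : Bornology.IsBounded Ω)
    (c : Set ℚ_[p] → ℚ_[p]) (hc : ∀ B ∈ components Ω, c B ∈ B)
    (hσ : abscissa Ω < 1) :
    -- the tube formula with error term
    (∀ (S : ℝ → ℝ) (U : Set ℂ) (f : ℂ → ℂ) (κ C : ℝ) (T : ℤ → ℝ),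
      IsScreen S → (⨆ t, S t) < 1 →
      IsContinuation Ω U f → window S ⊆ U → (∀ t, ¬ IsPole f (screenPoint S t)) →
      IsLanguid f S κ C T →
      (∀ n : ℕ, {w | w ∈ visibleDimensions f (window S) ∧
        T (-n) < w.im ∧ w.im < T n}.Finite) ∧
      ∀ φ : ℝ → ℂ, IsTestFunction (Ioi 0) φ →
        IntegrableOn (fun ε => (tubeVolume Ω c ε : ℂ) * φ ε) (Ioi 0) ∧
        (∀ w ∈ visibleDimensions f (window S),
          IntegrableOn (fun ε => residueTerm p f w ε * φ ε) (Ioi 0)) ∧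
        Integrable (errorIntegrand p f S φ) ∧
        (∃ Z : ℂ,
          Tendsto (truncatedSum p f (visibleDimensions f (window S)) T φ) atTop (𝓝 Z) ∧
          pairing (fun ε => (tubeVolume Ω c ε : ℂ)) φ = Z + errorTerm p f S φ) ∧
        (fun a : ℝ => errorTerm p f S (dilate φ a)) =O[𝓝[>] 0]
          (fun a : ℝ => a ^ (1 - ⨆ t, S t))) ∧
    -- the exact tube formula in the strongly languid case
    (∀ (S : ℕ → ℝ → ℝ) (f : ℂ → ℂ) (κ A C : ℝ) (T : ℤ → ℝ),
      IsContinuation Ω univ f → IsStronglyLanguid f S κ A C T →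
      (∀ m n : ℕ, {w | w ∈ visibleDimensions f (window (S m)) ∧
        T (-n) < w.im ∧ w.im < T n}.Finite) ∧
      ∀ φ : ℝ → ℂ, IsTestFunction (Iio A⁻¹) φ →
        IntegrableOn (fun ε => (tubeVolume Ω c ε : ℂ) * φ ε) (Ioi 0) ∧
        (∀ w ∈ visibleDimensions f univ,
          IntegrableOn (fun ε => residueTerm p f w ε * φ ε) (Ioi 0)) ∧
        -- the sum over all complex dimensions, along the windows of the screens `S m`
        (∃ Z : ℕ → ℂ,
          (∀ᶠ m in atTop, Tendsto
            (truncatedSum p f (visibleDimensions f (window (S m))) T φ) atTop (𝓝 (Z m))) ∧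
          Tendsto Z atTop (𝓝 (pairing (fun ε => (tubeVolume Ω c ε : ℂ)) φ))) ∧
        -- the sum over all complex dimensions at once, if their real parts are bounded below
        ((∃ b : ℝ, ∀ w ∈ visibleDimensions f univ, b ≤ w.re) →
          Tendsto (truncatedSum p f (visibleDimensions f univ) T φ) atTop
            (𝓝 (pairing (fun ε => (tubeVolume Ω c ε : ℂ)) φ)))) := by
  have hσ' : abscissa Ω < ((1 : ℝ) : EReal) := by exact_mod_cast hσ
  constructor
  · intro S U f κ C T hS hsup hf hW hnp hL
    refine ⟨fun n => finite_visibleDimensions_strip hΩ hbdd hσ hf hS hW _ _, fun φ hφ => ?_⟩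
    obtain ⟨b, hb0, hb⟩ : ∃ b : ℝ, 0 < b ∧ tsupport φ ⊆ Iio b := by
      obtain ⟨b, hb⟩ := (show IsCompact (tsupport φ) from hφ.compact).bddAbove
      exact ⟨max b 0 + 1, by positivity, fun x hx =>
        ((hb hx).trans (le_max_left b 0)).trans_lt (lt_add_one _)⟩
    obtain ⟨a, ha, -, hv⟩ := exists_pos_lt_vanishing hφ.compact hb0 hb
    have hcont := hφ.smooth.continuous
    have hle : ∀ t, S t ≤ ⨆ t, S t := le_ciSup (bddAbove_range_of_isScreen hS)
    have hfan : ∀ t, AnalyticAt ℂ f (screenPoint S t) := fun t =>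
      analyticAt_of_not_isPole hf (hW (by simp [window, screenPoint])) (hnp t)
    obtain ⟨Q, hQ⟩ := exists_norm_screen_le hS hfan hL.const_pos fun t ht => (hL.vertical t ht).2
    have hint : Integrable (errorIntegrand p f S φ) :=
      integrable_errorIntegrand ha hφ.smooth hφ.compact hv hS hle hsup hfan hQ
    have hmain := tendsto_truncatedSum hΩ hbdd hc hσ hS hsup hf hW hnp hL.heights hL.const_pos
      hL.horizontal ha hφ.smooth hφ.compact hv hint
    exact ⟨integrableOn_tubeVolume_mul hbdd c hcont hφ.compact,
      fun w hw => integrableOn_residueTerm_mul p (hf.meromorphic (hW hw.1)).meromorphicAt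
        (re_lt_of_isPole hΩ hbdd hf (hW hw.1) hw.2 hσ') hcont hφ.compact hv,
      hint, ⟨_, hmain, by ring⟩, isBigO_errorTerm_dilate hS hint⟩
  · intro S f κ A C T hf hL
    refine ⟨fun m n => finite_visibleDimensions_strip hΩ hbdd hσ hf (hL.screens m)
      (subset_univ _) _ _, fun φ hφ => ?_⟩
    obtain ⟨a, ha, haA, hv⟩ :=
      exists_pos_lt_vanishing hφ.compact (inv_pos.2 hL.base_pos) hφ.support
    have hcont := hφ.smooth.continuous
    have herr := tendsto_errorTerm_zero (p := p) hL ha haA hφ.smooth hφ.compact hv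
    have hmain : ∀ᶠ m in atTop, Tendsto
        (truncatedSum p f (visibleDimensions f (window (S m))) T φ) atTop
        (𝓝 (pairing (fun ε => (tubeVolume Ω c ε : ℂ)) φ - errorTerm p f (S m) φ)) := by
      filter_upwards [hL.sup_tendsto.eventually_lt_atBot 1] with m hm
      have hle : ∀ t, S m t ≤ ⨆ t, S m t := le_ciSup (bddAbove_range_of_isScreen (hL.screens m))
      have hnp : ∀ t, ¬ IsPole f (screenPoint (S m) t) := fun t => (hL.vertical m t).1
      obtain ⟨M, hM⟩ := (hL.screens m).bounded
      have hA := hL.base_pos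
      have hC := hL.const_pos
      -- `A ^ |S m t|` is bounded, as the screen is
      obtain ⟨E, hE0, hE⟩ := exists_rpow_neg_le (inv_pos.2 hA) 0 M
      have hQ : ∀ t, ‖f (screenPoint (S m) t)‖ ≤ C * E * (|t| + 1) ^ κ := fun t => by
        refine (hL.vertical m t).2.trans ?_
        have h1 := hE |S m t| ⟨by simp, hM t⟩
        rw [Real.inv_rpow hA.le, Real.rpow_neg hA.le, inv_inv] at h1
        gcongr
      have hfan : ∀ t, AnalyticAt ℂ f (screenPoint (S m) t) := fun t =>
        analyticAt_of_not_isPole hf (mem_univ _) (hnp t)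
      exact tendsto_truncatedSum hΩ hbdd hc hσ (hL.screens m) hm hf (subset_univ _) hnp hL.heights
        hC (fun n u _ => hL.horizontal n u) ha hφ.smooth hφ.compact hv
        (integrable_errorIntegrand ha hφ.smooth hφ.compact hv (hL.screens m) hle hm hfan hQ)
    have hZ : Tendsto (fun m => pairing (fun ε => (tubeVolume Ω c ε : ℂ)) φ -
        errorTerm p f (S m) φ) atTop (𝓝 (pairing (fun ε => (tubeVolume Ω c ε : ℂ)) φ)) := by
      simpa using herr.const_sub (pairing (fun ε => (tubeVolume Ω c ε : ℂ)) φ)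
    refine ⟨integrableOn_tubeVolume_mul hbdd c hcont hφ.compact,
      fun w hw => integrableOn_residueTerm_mul p (hf.meromorphic (mem_univ w)).meromorphicAt
        (re_lt_of_isPole hΩ hbdd hf (mem_univ w) hw.2 hσ') hcont hφ.compact hv,
      ⟨_, hmain, hZ⟩, ?_⟩
    rintro ⟨b, hb⟩
    -- all windows far enough to the left contain all complex dimensions
    have hall : ∀ᶠ m in atTop,
        visibleDimensions f (window (S m)) = visibleDimensions f univ := by
      filter_upwards [hL.sup_tendsto.eventually_le_atBot b] with m hm
      have hle : ∀ t, S m t ≤ ⨆ t, S m t := le_ciSup (bddAbove_range_of_isScreen (hL.screens m))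
      ext w
      refine ⟨fun h => ⟨mem_univ _, h.2⟩, fun h => ⟨?_, h.2⟩⟩
      exact ((hle w.im).trans hm).trans (hb w h)
    have hconst : ∀ᶠ m in atTop, Tendsto (truncatedSum p f (visibleDimensions f univ) T φ) atTop
        (𝓝 (pairing (fun ε => (tubeVolume Ω c ε : ℂ)) φ - errorTerm p f (S m) φ)) := by
      filter_upwards [hall, hmain] with m h1 h2
      rwa [h1] at h2
    obtain ⟨m₀, hm₀⟩ := hconst.exists
    -- the limits along these windows all agree, so that the error terms, tending to `0`, vanish
    have heq := tendsto_nhds_unique (tendsto_const_nhds.congr' (hconst.mono fun m hm =>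
      tendsto_nhds_unique hm₀ hm)) hZ
    rwa [heq] at hm₀
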